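/- **Proposition.** Let $I$ be a finite set, $\emptyset\ne J\subset I$, let $\omega:\mathbb R^I\to\mathbb R^I$ be a nonsingular linear map and let $\gamma_j>0$ for $j\in J$. For $j\in J$ let $\iota_j=\delta_j\langle\delta_j,\cdot\rangle:\mathbb R^J\to\mathbb R^I$, and write $\gamma\iota^*\iota=\sum_{j}\gamma_j\iota_j^*\iota_j$, $\lambda\iota=\sum_j\lambda_j\iota_j$, $\lambda\iota^*=\sum_j\lambda_j\iota_j^*$, $\lambda^2\iota\iota^*=\sum_j\lambda_j^2\iota_j\iota_j^*$. There is $\lambda_0>0$ (depending only on $I,J,\omega,\gamma$) such that the following holds for all $(\lambda_j)_{j\in J}$ with $0<\lambda_j\le\lambda_0$. There exist linear maps $\tilde\omega:\mathbb R^I\to\mathbb R^I$ with $\tilde\omega^*\tilde\omega=\omega^*\omega-\lambda^2\iota\iota^*$, and each such $\tilde\omega$ is nonsingular. Fix such an $\tilde\omega$ and assume * (K) the pair $(\omega^*\omega,\sum_{j\in J}\iota_j\iota_j^*)$ satisfies the Kalman condition: with $N=|I|$, every $x\in\mathbb R^I$ is of the form $\sum_{k=0}^{N-1}(\omega^*\omega)^k\big(\sum_j\iota_j\iota_j^*\big)y_k$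 with $y_0,\dots,y_{N-1}\in\mathbb R^I$. Then there is a scalar product $\langle\cdot,\cdot\rangle$ on $\mathbb R^J\oplus\mathbb R^I\oplus\mathbb R^I$, with norm $\|\cdot\|$ (chosen before, and independently of, $U$), such that for every $U:\mathbb R^I\to\mathbb R$ satisfying * (G) $U$ is smooth, and $\nabla U$ is globally Lipschitz with $|\nabla U(q)|=o\big(1+|q|^{1/(4|I|)}\big)$ as $|q|\to\infty$; * (pH) there is a sequence $(q^{(n)})$ in $\mathbb R^I$, bounded away from $0$, with $\lim_{n\to\infty}|q^{(n)}|^k\|D^{k+1}U(q^{(n)})\|=0$ for each $k=0,1,\dots,|I|-1$; the control system in $\mathbb R^J\oplus\mathbb R^I\oplus\mathbb R^I$ with state $X=(r,p,\tilde\omega q)$ and control $\zeta$ with values in $\mathbb R^J$, $$\begin{pmatrix}\dot r\\ \dot p\\ \tilde\omega\dot q\end{pmatrix}=\begin{pmatrix}-\gamma\iota^*\iota&\lambda\iota^*&0\\-\lambda\iota&0&-\tilde\omega^*\\0&\tilde\omega&0\end{pmatrix}\begin{pmatrix}r\\p\\\tilde\omega q\end{pmatrix}-\begin{pmatrix}0\\\nabla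 U(q)\\0\end{pmatrix}+\begin{pmatrix}\mathbf 1\\0\\0\end{pmatrix}\zeta,$$ that is $\dot X=f(X)+B\zeta$, has a unique solution on $[0,T]$ for every $T>0$, every initial condition $X_0=x$ and every $\zeta\in C([0,T];\mathbb R^J)$; and, writing $S_T(x,\zeta)=X_T$, * (C1) there are $\alpha,\beta>0$ with $\langle f(y),y\rangle\le-\alpha\|y\|^2+\beta$ for all $y$; and there is a point $\hat x$ in $\mathbb R^J\oplus\mathbb R^I\oplus\mathbb R^I$ such that (the choice of norm is irrelevant in what follows) * (C2) for all $\epsilon,R>0$ there is $T>0$ such that for every $x$ with $\|x\|\le R$ there is $\zeta\in C([0,T];\mathbb R^J)$ with $\|S_T(x,\zeta)-\hat x\|<\epsilon$; * (C3) there are $\epsilon_0>0$, $T_0>0$, a compact set $\mathcal K\subset C([0,T_0];\mathbb R^J)$ and a closed ball $G\subset\mathbb R^J\oplus\mathbb R^I\oplus\mathbb R^I$ of positive radius such that every continuous $\Phi:\mathcal K\to\mathbb R^J\oplus\mathbb R^I\oplus\mathbb R^I$ with $\sup_{\zeta\in\mathcal K}\|\Phi(\zeta)-S_{T_0}(\hat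 x,\zeta)\|\le\epsilon_0$ satisfies $G\subset\Phi(\mathcal K)$. -/

import Mathlib

open Filter Topology Matrix


noncomputable section

/-! ## Control systems `Ẋ = f X + B ζ` -/

namespace Ctrl

variable {V W : Type*} [NormedAddCommGroup V] [NormedSpace ℝ V]
  [NormedAddCommGroup W] [NormedSpace ℝ W]

/-- `X` solves `Ẋ = f X + B ζ` on `[0, T]` with `X 0 = x`. Only the values of `X` on `[0, T]`
matter (the derivatives at the endpoints are one-sided). -/
structure IsTrajectory (f : V → V) (B : W →ₗ[ℝ] V) (T : ℝ) (x : V)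
    (ζ : C(Set.Icc (0 : ℝ) T, W)) (X : ℝ → V) : Prop where
  initial : X 0 = x
  ode : ∀ t (ht : t ∈ Set.Icc (0 : ℝ) T),
    HasDerivWithinAt X (f (X t) + B (ζ ⟨t, ht⟩)) (Set.Icc 0 T) t

/-- For every `T > 0`, initial condition and continuous control, the controlled problem has
exactly one solution on `[0, T]`. -/
def WellPosed (f : V → V) (B : W →ₗ[ℝ] V) : Prop :=
  ∀ T : ℝ, 0 < T → ∀ (x : V) (ζ : C(Set.Icc (0 : ℝ) T, W)),
    ∃ X : ℝ → V, IsTrajectory f B T x ζ X ∧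
      ∀ Y : ℝ → V, IsTrajectory f B T x ζ Y → Set.EqOn Y X (Set.Icc 0 T)

/-- The resolving map `S_T(x, ζ)`: the value at time `T` of the solution of the controlled
problem. It is meaningful for well-posed systems, see `endpointMap_eq`. -/
def endpointMap (f : V → V) (B : W →ₗ[ℝ] V) (T : ℝ) (x : V)
    (ζ : C(Set.Icc (0 : ℝ) T, W)) : V :=
  Classical.epsilon (fun X : ℝ → V => IsTrajectory f B T x ζ X) T

theorem endpointMap_eq {f : V → V} {B : W →ₗ[ℝ] V} (h : WellPosed f B) {T : ℝ} (hT : 0 < T)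
    {x : V} {ζ : C(Set.Icc (0 : ℝ) T, W)} {X : ℝ → V} (hX : IsTrajectory f B T x ζ X) :
    endpointMap f B T x ζ = X T := by
  obtain ⟨Z, -, hZ⟩ := h T hT x ζ
  have hmem : T ∈ Set.Icc (0 : ℝ) T := ⟨hT.le, le_rfl⟩
  have he : IsTrajectory f B T x ζ
      (Classical.epsilon (fun X : ℝ → V => IsTrajectory f B T x ζ X)) :=
    Classical.epsilon_spec (p := fun X : ℝ → V => IsTrajectory f B T x ζ X) ⟨X, hX⟩
  exact (hZ _ he hmem).trans (hZ _ hX hmem).symm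

/-- `g` is a scalar product. -/
def IsScalarProduct (g : V →ₗ[ℝ] V →ₗ[ℝ] ℝ) : Prop :=
  (∀ u v, g u v = g v u) ∧ ∀ u, u ≠ 0 → 0 < g u u

/-- Condition (C1), dissipativity, for the scalar product `g`:
`⟨f y, y⟩ ≤ - α ‖y‖² + β` for all `y`. -/
def Dissipative (g : V →ₗ[ℝ] V →ₗ[ℝ] ℝ) (f : V → V) : Prop :=
  ∃ α > (0 : ℝ), ∃ β > (0 : ℝ), ∀ y, g (f y) y ≤ -α * g y y + β

/-- Condition (C2), approximate controllability to the point `xhat`. -/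
def ApproxControllableTo (f : V → V) (B : W →ₗ[ℝ] V) (xhat : V) : Prop :=
  ∀ ε > (0 : ℝ), ∀ R > (0 : ℝ), ∃ T > (0 : ℝ), ∀ x : V, ‖x‖ ≤ R →
    ∃ ζ : C(Set.Icc (0 : ℝ) T, W), ‖endpointMap f B T x ζ - xhat‖ < ε

/-- Condition (C3), solid controllability from the point `xhat`. -/
def SolidlyControllableFrom (f : V → V) (B : W →ₗ[ℝ] V) (xhat : V) : Prop :=
  ∃ ε₀ > (0 : ℝ), ∃ T₀ > (0 : ℝ), ∃ 𝒦 : Set C(Set.Icc (0 : ℝ) T₀, W), IsCompact 𝒦 ∧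
    ∃ z : V, ∃ ρ > (0 : ℝ), ∀ Φ : 𝒦 → V, Continuous Φ →
      (∀ ζ : 𝒦, ‖Φ ζ - endpointMap f B T₀ xhat ζ‖ ≤ ε₀) →
        Metric.closedBall z ρ ⊆ Set.range Φ

end Ctrl

/-! ## Networks of oscillators -/

namespace Network

/-- The Kalman condition on `(A, B)`: every `x` is `B y₀ + A B y₁ + ⋯ + A^(d-1) B y_(d-1)`. -/
def Kalman {m n : Type*} [Fintype m] [DecidableEq m] [Fintype n]
    (A : Matrix m m ℝ) (B : Matrix m n ℝ) : Prop :=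
  ∀ x : m → ℝ, ∃ y : Fin (Fintype.card m) → n → ℝ, x = ∑ k : Fin (Fintype.card m), (A ^ (k : ℕ) * B) *ᵥ y k

variable {I : Type*} [Fintype I] [DecidableEq I]

/-- Condition (G): the gradient of `U` is a smooth, globally Lipschitz vector field growing
strictly slower than `1 + |q| ^ (1 / (4 |I|))`. -/
structure GrowthCondition (U : EuclideanSpace ℝ I → ℝ) : Prop where
  smooth : ContDiff ℝ ((⊤ : ℕ∞) : WithTop ℕ∞) U
  lipschitz : ∃ L, LipschitzWith L (gradient U)
  growth : gradient U =o[cocompact (EuclideanSpace ℝ I)]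
    fun q => 1 + ‖q‖ ^ (1 / (4 * (Fintype.card I : ℝ)))

/-- Condition (pH): along some sequence of points bounded away from `0`,
`|q|^k ‖D^(k+1) U (q)‖ → 0` for `k = 0, …, |I| - 1`. -/
def PerturbationCondition (U : EuclideanSpace ℝ I → ℝ) : Prop :=
  ∃ q : ℕ → EuclideanSpace ℝ I, (∃ c > (0 : ℝ), ∀ n, c ≤ ‖q n‖) ∧
    ∀ k < Fintype.card I,
      Tendsto (fun n => ‖q n‖ ^ k * ‖iteratedFDeriv ℝ (k + 1) U (q n)‖) atTop (𝓝 0)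

variable {J : Finset I}

/-- The rank-one map `ι_j = δ_j ⟨δ_j, ·⟩ : ℝ^J → ℝ^I`. -/
def iota (j : J) : Matrix I J ℝ := Matrix.single (j : I) j 1

/-- The linear part of the system, acting on `(r, p, ω̃ q) ∈ ℝ^J ⊕ ℝ^I ⊕ ℝ^I`. -/
def driftMatrix (γ lam : J → ℝ) (ωt : Matrix I I ℝ) : Matrix (J ⊕ I ⊕ I) (J ⊕ I ⊕ I) ℝ :=
  Matrix.fromBlocks
    (-∑ j, γ j • ((iota j)ᵀ * iota j)) (Matrix.fromCols (∑ j, lam j • (iota j)ᵀ) 0)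
    (Matrix.fromRows (-∑ j, lam j • iota j) 0) (Matrix.fromBlocks 0 (-ωtᵀ) ωt 0)

/-- The position `q`, recovered from the state `x = (r, p, ω̃ q)`. -/
def position (ωt : Matrix I I ℝ) (x : EuclideanSpace ℝ (J ⊕ I ⊕ I)) : EuclideanSpace ℝ I :=
  WithLp.toLp 2 (ωt⁻¹ *ᵥ fun i => x (Sum.inr (Sum.inr i)))

/-- The vector field `f` of the undriven semi-Markovian system: the linear part minus
`(0, ∇U(q), 0)`. -/
def semiMarkovField (γ lam : J → ℝ) (ωt : Matrix I I ℝ) (U : EuclideanSpace ℝ I → ℝ)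
    (x : EuclideanSpace ℝ (J ⊕ I ⊕ I)) : EuclideanSpace ℝ (J ⊕ I ⊕ I) :=
  WithLp.toLp 2 (driftMatrix γ lam ωt *ᵥ x.ofLp
    - Sum.elim (0 : J → ℝ) (Sum.elim (gradient U (position ωt x)).ofLp (0 : I → ℝ)))

/-- The control operator `ζ ↦ (ζ, 0, 0)`. -/
def controlMap (J : Finset I) : EuclideanSpace ℝ J →ₗ[ℝ] EuclideanSpace ℝ (J ⊕ I ⊕ I) :=
  Matrix.toEuclideanLin (Matrix.fromRows (1 : Matrix J J ℝ) (0 : Matrix (I ⊕ I) J ℝ))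

end Network

end

/-! The field is f = A + F: A is linear, and F(x) = -(0, ∇U(q), 0) is globally Lipschitz and of
sublinear growth. The linear pair (A, B) therefore decides everything.

Its algebra is `eq_zero_of_driftMatrix_pow`: under the Kalman condition no nonzero state has outputs
B*Aᵏx all zero. Since A* is A with λ and ω̃ negated, the pair (A*, B*) is observable too, which is
controllability of (A, B).

Dissipativity: ⟨Ax, x⟩ = -Σ γ_j r_j² only sees the output r, but observability makes the norm
decrease strictly along e^{tA} over every time interval. With P = ∫₀¹ e^{sA*}e^{sA} ds, ⟨PAx, x⟩ =
(|e^A x|² - |x|²)/2 is negative definite, so ⟨P·, ·⟩ is the required scalar product. It depends only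
on A, and sublinear terms are absorbed (`exists_isScalarProduct_dissipative`).

Controllability: controls linear in z steer the linear system from 0 to z in time 1. By Gronwall,
for the full system started in a fixed ball they give an endpoint within o(R) of z, uniformly for
|z| ≤ R (`exists_control_family`). A map that close to the identity on a large ball covers a smaller
ball, by Brouwer. This gives exact controllability in time 1, and the covering is stable under small
uniform perturbations of the endpoint map (`controllable_of_sublinear`). -/

/-! ### Radial truncation, used to extend maps off a ball. -/

section RadialRetraction

variable {E : Type*} [NormedAddCommGroup E] [NormedSpace ℝ E]

/-- The radial retraction of a normed space onto the closed ball of radius `ρ`. -/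
noncomputable def radialRetraction (ρ : ℝ) (x : E) : E := (ρ / max ρ ‖x‖) • x

theorem radialRetraction_of_norm_le {ρ : ℝ} (hρ : 0 < ρ) {x : E} (hx : ‖x‖ ≤ ρ) :
    radialRetraction ρ x = x := by
  simp [radialRetraction, max_eq_left hx, div_self hρ.ne']

theorem norm_radialRetraction {ρ : ℝ} (hρ : 0 < ρ) (x : E) :
    ‖radialRetraction ρ x‖ = ρ / max ρ ‖x‖ * ‖x‖ := by
  rw [radialRetraction, norm_smul, Real.norm_of_nonneg (by positivity)]

theorem norm_radialRetraction_le {ρ : ℝ} (hρ : 0 < ρ) (x : E) : ‖radialRetraction ρ x‖ ≤ ρ := by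
  have h : 0 < max ρ ‖x‖ := lt_max_of_lt_left hρ
  rw [norm_radialRetraction hρ, div_mul_eq_mul_div, div_le_iff₀ h]
  gcongr
  exact le_max_right _ _

theorem norm_radialRetraction_le_norm {ρ : ℝ} (hρ : 0 < ρ) (x : E) :
    ‖radialRetraction ρ x‖ ≤ ‖x‖ := by
  have h : 0 < max ρ ‖x‖ := lt_max_of_lt_left hρ
  rw [norm_radialRetraction hρ]
  exact mul_le_of_le_one_left (norm_nonneg x) ((div_le_one h).2 (le_max_left _ _))

theorem norm_radialRetraction_of_le {ρ : ℝ} (hρ : 0 < ρ) {x : E} (hx : ρ ≤ ‖x‖) :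
    ‖radialRetraction ρ x‖ = ρ := by
  have h : 0 < ‖x‖ := hρ.trans_le hx
  rw [norm_radialRetraction hρ, max_eq_right hx, div_mul_cancel₀ _ h.ne']

theorem lipschitzWith_radialRetraction {ρ : ℝ} (hρ : 0 < ρ) :
    LipschitzWith 2 (radialRetraction ρ : E → E) := by
  refine LipschitzWith.of_dist_le_mul fun x y => ?_
  rw [dist_eq_norm, dist_eq_norm]
  have ha : 0 < max ρ ‖x‖ := lt_max_of_lt_left hρ
  have hb : 0 < max ρ ‖y‖ := lt_max_of_lt_left hρ
  set a := max ρ ‖x‖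
  set b := max ρ ‖y‖
  have hab : |b - a| ≤ ‖x - y‖ := by
    refine (abs_max_sub_max_le_max ρ ‖y‖ ρ ‖x‖).trans ?_
    rw [sub_self, abs_zero, max_eq_right (abs_nonneg _), norm_sub_rev]
    exact abs_norm_sub_norm_le y x
  have h1 : ρ / a ≤ 1 := (div_le_one ha).2 (le_max_left _ _)
  have h2 : ‖y‖ / b ≤ 1 := (div_le_one hb).2 (le_max_right _ _)
  -- Each of the two terms has norm at most ‖x - y‖, whence the constant 2.
  have key : radialRetraction ρ x - radialRetraction ρ y
      = (ρ / a) • (x - y) + ((ρ / a) * ((b - a) / b)) • y := by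
    have : ρ / b = ρ / a - (ρ / a) * ((b - a) / b) := by field_simp; ring
    simp only [radialRetraction]
    change (ρ / a) • x - (ρ / b) • y = _
    rw [this, sub_smul, smul_sub]
    abel
  rw [key]
  calc ‖(ρ / a) • (x - y) + ((ρ / a) * ((b - a) / b)) • y‖
      ≤ ‖(ρ / a) • (x - y)‖ + ‖((ρ / a) * ((b - a) / b)) • y‖ := norm_add_le _ _
    _ = ρ / a * ‖x - y‖ + ρ / a * |b - a| * (‖y‖ / b) := by
        have h3 : ‖ρ / a‖ = ρ / a := Real.norm_of_nonneg (by positivity)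
        rw [norm_smul, norm_smul, norm_mul, h3, norm_div, Real.norm_of_nonneg hb.le,
          Real.norm_eq_abs]
        ring
    _ ≤ 1 * ‖x - y‖ + 1 * ‖x - y‖ * 1 := by gcongr
    _ = (2 : NNReal) * ‖x - y‖ := by push_cast; ring

end RadialRetraction

/-! ## A covering form of Brouwer's theorem -/

namespace Brouwer

open MeasureTheory Metric Set Polynomial

variable {E : Type*} [NormedAddCommGroup E]

/-- Solving x + G x = y means finding the fixed point of the contraction x ↦ y - G x. -/
theorem bijective_id_add_of_lipschitz [CompleteSpace E] {G : E → E} {K : NNReal} (hK : K < 1)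
    (hG : LipschitzWith K G) : Function.Bijective fun x => x + G x := by
  constructor
  · intro x y hxy
    have h1 : x - y = G y - G x := by
      have : x + G x = y + G y := hxy
      rw [sub_eq_sub_iff_add_eq_add, this]; abel
    have h2 : dist x y ≤ K * dist x y := by
      conv_lhs => rw [dist_eq_norm, h1, ← dist_eq_norm, dist_comm]
      exact hG.dist_le_mul x y
    have hK' : (K : ℝ) < 1 := by exact_mod_cast hK
    have := dist_nonneg (x := x) (y := y)
    exact dist_le_zero.1 (by nlinarith)
  · intro y
    have hc : ContractingWith K fun x => y - G x :=
      ⟨hK, LipschitzWith.of_dist_le_mul fun a b => by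
        rw [dist_sub_left]; exact hG.dist_le_mul a b⟩
    refine ⟨ContractingWith.fixedPoint _ hc, ?_⟩
    have := hc.fixedPoint_isFixedPt
    have h : y - G (ContractingWith.fixedPoint _ hc) = ContractingWith.fixedPoint _ hc := this
    change ContractingWith.fixedPoint _ hc + G (ContractingWith.fixedPoint _ hc) = y
    nth_rw 1 [← h]
    abel

/-- The Leibniz formula, with each product of sums expanded over subsets, is a finite sum of powers
of t with integrable coefficients. Polynomiality is what later carries an identity from small t to t
= 1. -/
theorem exists_polynomial_integral_det {X n : Type*} [TopologicalSpace X] [MeasurableSpace X]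
    [OpensMeasurableSpace X] [Fintype n] [DecidableEq n] (μ : Measure X)
    [IsFiniteMeasureOnCompacts μ] {s : Set X} (hs : IsCompact s) (hs' : MeasurableSet s)
    {M : X → Matrix n n ℝ} (hM : ContinuousOn M s) :
    ∃ p : ℝ[X], ∀ t : ℝ, ∫ x in s, (1 + t • M x).det ∂μ = p.eval t := by
  -- `S` collects the factors taken from the identity matrix; each remaining factor contributes one
  -- power of t.
  let c : Equiv.Perm n → Finset n → X → ℝ := fun σ S x =>
    (Equiv.Perm.sign σ : ℤ) * ((∏ i ∈ S, (1 : Matrix n n ℝ) (σ i) i) *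
      ∏ i ∈ Finset.univ \ S, M x (σ i) i)
  have hc : ∀ σ S, IntegrableOn (c σ S) s μ := by
    intro σ S
    refine ContinuousOn.integrableOn_compact' hs hs' ?_
    refine continuousOn_const.mul (continuousOn_const.mul ?_)
    refine continuousOn_finsetProd _ fun i _ => ?_
    exact (continuous_apply i).comp_continuousOn ((continuous_apply (σ i)).comp_continuousOn hM)
  refine ⟨∑ σ : Equiv.Perm n, ∑ S ∈ (Finset.univ : Finset n).powerset,
    C (∫ x in s, c σ S x ∂μ) * Polynomial.X ^ (Finset.univ \ S).card, fun t => ?_⟩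
  have hdet : ∀ x, (1 + t • M x).det = ∑ σ : Equiv.Perm n,
      ∑ S ∈ (Finset.univ : Finset n).powerset, c σ S x * t ^ (Finset.univ \ S).card := by
    intro x
    rw [Matrix.det_apply']
    refine Finset.sum_congr rfl fun σ _ => ?_
    simp only [Matrix.add_apply, Matrix.smul_apply, smul_eq_mul]
    rw [Finset.prod_add, Finset.mul_sum]
    refine Finset.sum_congr rfl fun S _ => ?_
    rw [Finset.prod_mul_distrib, Finset.prod_const]
    simp only [c]
    ring
  simp_rw [hdet]
  rw [integral_finsetSum _ fun σ _ => integrable_finsetSum _ fun S _ => (hc σ S).mul_const _]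
  simp only [eval_finsetSum, eval_mul, eval_C, eval_pow, eval_X]
  refine Finset.sum_congr rfl fun σ _ => ?_
  rw [integral_finsetSum _ fun S _ => (hc σ S).mul_const _]
  exact Finset.sum_congr rfl fun S _ => integral_mul_const _ _

variable [InnerProductSpace ℝ E] [FiniteDimensional ℝ E]

theorem exists_polynomial_integral_continuousLinearMap_det [MeasurableSpace E] [BorelSpace E]
    (μ : Measure E) [IsFiniteMeasureOnCompacts μ] {s : Set E} (hs : IsCompact s)
    {M : E → E →L[ℝ] E} (hM : ContinuousOn M s) :
    ∃ p : ℝ[X], ∀ t : ℝ, ∫ x in s, (1 + t • M x).det ∂μ = p.eval t := by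
  classical
  let b := Module.finBasis ℝ E
  let Φ : (E →L[ℝ] E) →ₗ[ℝ] Matrix (Fin (Module.finrank ℝ E)) (Fin (Module.finrank ℝ E)) ℝ :=
    (LinearMap.toMatrix b b).toLinearMap ∘ₗ ContinuousLinearMap.coeLM ℝ
  have hΦ : Continuous Φ := Φ.continuous_of_finiteDimensional
  obtain ⟨p, hp⟩ := exists_polynomial_integral_det μ hs hs.measurableSet
    (hΦ.comp_continuousOn hM)
  refine ⟨p, fun t => ?_⟩
  rw [← hp]
  congr 1
  ext x
  have h1 : (1 + t • Φ (M x)) = Φ (1 + t • M x) := by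
    rw [map_add, map_smul]
    congr 1
    exact (LinearMap.toMatrix_one b).symm
  change _ = (1 + t • Φ (M x)).det
  rw [h1]
  exact (LinearMap.det_toMatrix b _).symm

/-- There is no `C¹` retraction of a ball onto its boundary sphere. -/
theorem no_contDiff_retraction {R : ℝ} (hR : 0 < R) {f : E → E} (hf : ContDiff ℝ 1 f)
    (hnorm : ∀ x, ‖f x‖ = R) (hfix : ∀ x, ‖x‖ = R → f x = x) : False := by
  let _ : MeasurableSpace E := borel E
  have : BorelSpace E := ⟨rfl⟩
  let μ : Measure E := Measure.addHaar
  set B : Set E := closedBall 0 R with hB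
  have hBc : IsCompact B := isCompact_closedBall 0 R
  -- The volume of the image of the ball under x + t g(x) is compared at small t, where this map
  -- permutes the ball, and at t = 1, where it is f.
  set g : E → E := fun x => f x - x with hgdef
  have hg : ContDiff ℝ 1 g := hf.sub contDiff_id
  have hg' : Continuous (fderiv ℝ g) := hg.continuous_fderiv one_ne_zero
  have hgd : ∀ x, HasFDerivAt g (fderiv ℝ g x) x := fun x =>
    (hg.differentiable one_ne_zero x).hasFDerivAt
  obtain ⟨C, hC⟩ := hBc.exists_bound_of_continuousOn hg'.continuousOn
  have hC0 : 0 ≤ C := (norm_nonneg _).trans (hC 0 (mem_closedBall_self hR.le))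
  lift C to NNReal using hC0
  have hlip : LipschitzOnWith C g B :=
    (convex_closedBall (0 : E) R).lipschitzOnWith_of_nnnorm_hasFDerivWithin_le
      (fun x _ => (hgd x).hasFDerivWithinAt) fun x hx => by exact_mod_cast hC x hx
  have hretr : ∀ x : E, radialRetraction R x ∈ B := fun x =>
    mem_closedBall_zero_iff.2 (norm_radialRetraction_le hR x)
  have hG : LipschitzWith (C * 2) (g ∘ radialRetraction R) := by
    rw [← lipschitzOnWith_univ]
    exact hlip.comp (lipschitzWith_radialRetraction hR).lipschitzOnWith fun x _ => hretr x
  -- Precomposing g with the retraction gives a bijection of the whole space. It fixes every point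
  -- outside the ball, because g vanishes on the sphere; so preimages of points of the ball lie in
  -- the ball.
  have himage : ∀ t : ℝ, 0 ≤ t → t ≤ 1 → t * (C * 2) < 1 →
      InjOn (fun x => x + t • g x) B ∧ (fun x => x + t • g x) '' B = B := by
    intro t ht0 ht1 ht
    have hbij : Function.Bijective fun x => x + t • g (radialRetraction R x) := by
      lift t to NNReal using ht0
      refine bijective_id_add_of_lipschitz (K := t * (C * 2)) (by exact_mod_cast ht) ?_
      refine LipschitzWith.of_dist_le_mul fun x y => ?_
      rw [dist_smul₀, NNReal.coe_mul, mul_assoc, NNReal.norm_eq]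
      exact mul_le_mul_of_nonneg_left (hG.dist_le_mul x y) t.2
    have heq : ∀ x ∈ B, x + t • g (radialRetraction R x) = x + t • g x := fun x hx => by
      rw [radialRetraction_of_norm_le hR (mem_closedBall_zero_iff.1 hx)]
    refine ⟨fun x hx y hy hxy => hbij.1 ?_, Subset.antisymm ?_ ?_⟩
    · simpa only [heq x hx, heq y hy] using hxy
    · rintro _ ⟨x, hx, rfl⟩
      have h : x + t • g x = (1 - t) • x + t • f x := by
        simp only [hgdef, smul_sub, sub_smul, one_smul]; abel
      rw [hB]
      simp only [h]
      refine convex_closedBall (0 : E) R hx ?_ (by linarith) ht0 (by ring)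
      exact mem_closedBall_zero_iff.2 (hnorm x).le
    · intro y hy
      obtain ⟨x, hx⟩ := hbij.2 y
      by_cases hxB : x ∈ B
      · exact ⟨x, hxB, by rw [← hx]; exact (heq x hxB).symm⟩
      · have hxR : R < ‖x‖ := by simpa [hB] using hxB
        have : g (radialRetraction R x) = 0 := by
          simp only [hgdef]
          rw [hfix _ (norm_radialRetraction_of_le hR hxR.le), sub_self]
        simp only [this, smul_zero, add_zero] at hx
        exact absurd (hx ▸ hy) hxB
  obtain ⟨p, hp⟩ := exists_polynomial_integral_continuousLinearMap_det μ hBc hg'.continuousOn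
  have hdetpos : ∃ δ > (0 : ℝ), ∀ M : E →L[ℝ] E, ‖M‖ < δ → 0 < (1 + M).det := by
    have hcont : ContinuousAt (fun M : E →L[ℝ] E => (1 + M).det) 0 :=
      (ContinuousLinearMap.continuous_det.comp (continuous_const.add continuous_id)).continuousAt
    have h0 : (0 : ℝ) < (fun M : E →L[ℝ] E => (1 + M).det) 0 := by
      simp only [add_zero]
      rw [show ((1 : E →L[ℝ] E).det) = 1 from LinearMap.det_id]
      exact one_pos
    obtain ⟨δ, hδ, h⟩ := Metric.eventually_nhds_iff.1 (hcont.eventually_const_lt h0)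
    exact ⟨δ, hδ, fun M hM => h (by simpa using hM)⟩
  obtain ⟨δ, hδ, hdet⟩ := hdetpos
  have hCpos : (0 : ℝ) < C + 1 := by positivity
  -- The first bound gives bijectivity, the second a positive Jacobian determinant, so that its
  -- integral is the volume of the image.
  set τ : ℝ := min (1 / (C * 2 + 1)) (δ / (C + 1)) with hτ
  have hτpos : 0 < τ := by positivity
  have hsmall : ∀ t ∈ Ioo 0 τ, p.eval t = (Polynomial.C (μ.real B)).eval t := by
    rintro t ⟨ht0, htτ⟩
    have h1 : t * (C * 2 + 1) < 1 := by
      rw [← lt_div_iff₀ (by positivity)]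
      exact htτ.trans_le (min_le_left _ _)
    have h2 : t * (C + 1) < δ := by
      rw [← lt_div_iff₀ hCpos]
      exact htτ.trans_le (min_le_right _ _)
    have hC0 : (0 : ℝ) ≤ C := C.2
    have ht1 : t ≤ 1 := by nlinarith
    obtain ⟨hinj, himg⟩ := himage t ht0.le ht1 (by nlinarith)
    have hderiv : ∀ x ∈ B, HasFDerivWithinAt (fun x => x + t • g x) (1 + t • fderiv ℝ g x) B x :=
      fun x _ => ((hasFDerivAt_id x).add ((hgd x).const_smul t)).hasFDerivWithinAt
    have hpos : ∀ x ∈ B, 0 < (1 + t • fderiv ℝ g x).det := by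
      intro x hx
      refine hdet _ ?_
      rw [norm_smul, Real.norm_of_nonneg ht0.le]
      have := hC x hx
      nlinarith
    have hvol := lintegral_abs_det_fderiv_eq_addHaar_image μ hBc.measurableSet hderiv hinj
    have hcont : Continuous fun x => (1 + t • fderiv ℝ g x).det :=
      ContinuousLinearMap.continuous_det.comp (continuous_const.add (hg'.const_smul t))
    rw [himg] at hvol
    rw [← hp, eval_C, Measure.real, ← hvol, integral_eq_lintegral_of_nonneg_ae]
    · congr 1
      exact setLIntegral_congr_fun hBc.measurableSet fun x hx => by
        simp only [abs_of_pos (hpos x hx)]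
    · exact (ae_restrict_iff' hBc.measurableSet).2 (ae_of_all _ fun x hx => (hpos x hx).le)
    · exact hcont.aestronglyMeasurable
  have hpC : p = Polynomial.C (μ.real B) :=
    Polynomial.eq_of_infinite_eval_eq _ _ ((Ioo_infinite hτpos).mono hsmall)
  -- At t = 1 the derivative is Df. Differentiating ‖f‖² = R² shows that its range is orthogonal to
  -- f(x) ≠ 0, so it is not onto.
  have hzero : ∀ x, (1 + (1 : ℝ) • fderiv ℝ g x).det = 0 := by
    intro x
    by_contra hne
    have hfd : HasFDerivAt f (1 + (1 : ℝ) • fderiv ℝ g x) x := by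
      have := (hasFDerivAt_id (𝕜 := ℝ) x).add (hgd x)
      rw [one_smul]
      refine this.congr_of_eventuallyEq (Eventually.of_forall fun y => ?_)
      simp [hgdef]
    set D := 1 + (1 : ℝ) • fderiv ℝ g x
    have hsurj : Function.Surjective D := by
      have := (LinearMap.equivOfDetNeZero (D : E →ₗ[ℝ] E) hne).surjective
      exact this
    obtain ⟨v, hv⟩ := hsurj (f x)
    have h1 := hfd.norm_sq
    have h2 : (fun y => ‖f y‖ ^ 2) = fun _ => R ^ 2 := by ext y; rw [hnorm]
    rw [h2] at h1
    have h3 := congrArg (fun T : E →L[ℝ] ℝ => T v) (h1.unique (hasFDerivAt_const _ _))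
    simp [hv, hnorm, hR.ne'] at h3
  have hfin : μ.real B = 0 := by
    have h := hp 1
    rw [hpC, eval_C] at h
    rw [← h]
    simp only [hzero, integral_zero]
  have hBpos : 0 < μ B := measure_closedBall_pos μ 0 hR
  exact (ENNReal.toReal_pos hBpos.ne' hBc.measure_ne_top).ne' hfin

/-- A continuous map on a ball of radius `R` that moves no point by more than `R / 4` vanishes
somewhere. -/
theorem exists_zero_of_norm_sub_le {R : ℝ} (hR : 0 < R) {φ : E → E}
    (hφ : ContinuousOn φ (closedBall 0 R)) (hφR : ∀ z, ‖z‖ ≤ R → ‖φ z - z‖ ≤ R / 4) :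
    ∃ z, ‖z‖ ≤ R ∧ φ z = 0 := by
  by_contra! hne
  have hmem : ∀ {z : E}, z ∈ closedBall (0 : E) R ↔ ‖z‖ ≤ R := mem_closedBall_zero_iff
  obtain ⟨z₀, hz₀, hmin⟩ := (isCompact_closedBall (0 : E) R).exists_isMinOn
    ⟨0, mem_closedBall_self hR.le⟩ hφ.norm
  have hΔ : 0 < ‖φ z₀‖ := norm_pos_iff.2 (hne z₀ (hmem.1 hz₀))
  -- Zeros of φ are fixed points of h. The C¹ approximation k is closer to h than the minimum of
  -- ‖φ‖, so it has no fixed point where ‖z‖ ≤ R; also ‖k‖ < R/4 + R/4.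
  set h : E → E := fun z => radialRetraction R z - φ (radialRetraction R z) with hh
  have hretr : Continuous (radialRetraction R : E → E) :=
    (lipschitzWith_radialRetraction hR).continuous
  have hcont : Continuous h := hretr.sub
    (hφ.comp_continuous hretr fun z => hmem.2 (norm_radialRetraction_le hR z))
  obtain ⟨k, hk, hkh, -⟩ := hcont.exists_contDiff_approx 1 (ε := fun _ => min ‖φ z₀‖ (R / 4))
    continuous_const fun _ => by positivity
  have hk1 : ∀ z, ‖k z - h z‖ < ‖φ z₀‖ := fun z => by
    rw [← dist_eq_norm]; exact (hkh z).trans_le (min_le_left _ _)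
  have hk2 : ∀ z, ‖k z‖ < R / 2 := fun z => by
    have h1 : ‖k z - h z‖ < R / 4 := by
      rw [← dist_eq_norm]; exact (hkh z).trans_le (min_le_right _ _)
    have h2 : ‖h z‖ ≤ R / 4 := by
      rw [hh, norm_sub_rev]; exact hφR _ (norm_radialRetraction_le hR z)
    have h3 : ‖k z‖ ≤ ‖k z - h z‖ + ‖h z‖ := by
      simpa using norm_add_le (k z - h z) (h z)
    linarith
  let χ : ContDiffBump (0 : E) := ⟨3 * R / 4, R, by positivity, by linarith⟩
  -- The cutoff makes ψ the identity on the sphere. Where it is not 1, ‖z‖ > 3R/4 exceeds ‖k z‖ <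
  -- R/2, so ψ has no zero and can be normalised to a retraction.
  set ψ : E → E := fun z => z - χ z • k z with hψ
  have hψd : ContDiff ℝ 1 ψ := contDiff_id.sub (χ.contDiff.smul hk)
  have hψ0 : ∀ z, ψ z ≠ 0 := by
    intro z hz
    have hz' : z = χ z • k z := sub_eq_zero.1 hz
    by_cases hzR : ‖z‖ ≤ 3 * R / 4
    · have h1 : χ z = 1 := χ.one_of_mem_closedBall (mem_closedBall_zero_iff.2 hzR)
      rw [h1, one_smul] at hz'
      have hzR' : ‖z‖ ≤ R := by linarith
      have h2 : h z = z - φ z := by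
        simp only [hh, radialRetraction_of_norm_le hR hzR']
      have h3 := hk1 z
      rw [h2, ← hz', sub_sub_cancel] at h3
      exact absurd h3 (not_lt.2 (hmin (hmem.2 hzR')))
    · have h1 : ‖χ z • k z‖ ≤ 1 * ‖k z‖ := by
        rw [norm_smul, Real.norm_of_nonneg χ.nonneg]
        gcongr
        exact χ.le_one
      rw [← hz'] at h1
      have := hk2 z
      linarith
  refine no_contDiff_retraction hR (f := fun z => (R / ‖ψ z‖) • ψ z) ?_ ?_ ?_
  · exact (contDiff_const.div (hψd.norm ℝ hψ0) fun z => norm_ne_zero_iff.2 (hψ0 z)).smul hψd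
  · intro z
    have := norm_pos_iff.2 (hψ0 z)
    rw [norm_smul, Real.norm_of_nonneg (by positivity), div_mul_cancel₀ _ this.ne']
  · intro z hz
    have h1 : χ z = 0 := χ.zero_of_le_dist (by rw [dist_zero_right, hz])
    have h2 : ψ z = z := by simp [hψ, h1]
    simp only [h2, hz, div_self hR.ne', one_smul]

end Brouwer

/-! ## Global well-posedness for Lipschitz vector fields -/

namespace Ctrl

open Set

variable {V W : Type*} [NormedAddCommGroup V] [NormedSpace ℝ V]
  [NormedAddCommGroup W] [NormedSpace ℝ W]

theorem norm_le_gronwallBound_of_hasDerivWithinAt_Icc {X X' : ℝ → V} {T δ K ε : ℝ}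
    (hX : ∀ t ∈ Icc 0 T, HasDerivWithinAt X (X' t) (Icc 0 T) t) (h0 : ‖X 0‖ ≤ δ)
    (hbound : ∀ t ∈ Icc 0 T, ‖X' t‖ ≤ K * ‖X t‖ + ε) :
    ∀ t ∈ Icc 0 T, ‖X t‖ ≤ gronwallBound δ K ε t := by
  intro t ht
  have := norm_le_gronwallBound_of_norm_deriv_right_le (f := X) (f' := X')
    (HasDerivWithinAt.continuousOn hX)
    (fun s hs => (hX s (Ico_subset_Icc_self hs)).mono_of_mem_nhdsWithin
      (Icc_mem_nhdsGE_of_mem hs)) h0 (fun s hs => hbound s (Ico_subset_Icc_self hs)) t ht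
  rwa [sub_zero] at this

/-- Truncating f radially makes the field bounded, so Picard–Lindelöf reaches time T in one step.
The Gronwall bound does not depend on the truncation radius; a radius above that bound leaves f
unchanged along the solution. -/
theorem exists_hasDerivWithinAt_of_lipschitzWith [CompleteSpace V] {f : V → V} {K : NNReal}
    (hf : LipschitzWith K f) {T : ℝ} (hT : 0 ≤ T) {c : ℝ → V} (hc : Continuous c) (x : V) :
    ∃ X : ℝ → V, X 0 = x ∧
      ∀ t ∈ Icc 0 T, HasDerivWithinAt X (f (X t) + c t) (Icc 0 T) t := by
  obtain ⟨M, hM⟩ := (isCompact_Icc (a := (0 : ℝ)) (b := T)).exists_bound_of_continuousOn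
    hc.continuousOn
  have hM0 : 0 ≤ M := (norm_nonneg _).trans (hM 0 ⟨le_rfl, hT⟩)
  have hfK : ∀ y, ‖f y‖ ≤ K * ‖y‖ + ‖f 0‖ := by
    intro y
    have h1 := hf.dist_le_mul y 0
    rw [dist_eq_norm, dist_zero_right] at h1
    have h2 := norm_le_norm_sub_add (f y) (f 0)
    linarith
  have hε : 0 ≤ ‖f 0‖ + M := by positivity
  set ρ : ℝ := gronwallBound ‖x‖ K (‖f 0‖ + M) T + 1 with hρdef
  have hmono := gronwallBound_mono (norm_nonneg x) hε K.coe_nonneg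
  have hρ : 0 < ρ := by
    have := hmono hT
    rw [gronwallBound_x0] at this
    have := norm_nonneg x
    linarith
  have hKρ : 0 ≤ K * ρ + (‖f 0‖ + M) := by positivity
  lift K * ρ + (‖f 0‖ + M) to NNReal using hKρ with L hL
  have hpl : IsPicardLindelof (fun t y => f (radialRetraction ρ y) + c t)
      (⟨0, ⟨le_rfl, hT⟩⟩ : Icc (0 : ℝ) T) x (L * T.toNNReal) 0 L (K * 2) := by
    refine ⟨fun t _ => ?_, fun y _ => ?_, fun t ht y _ => ?_, ?_⟩
    · refine LipschitzWith.lipschitzOnWith (LipschitzWith.of_dist_le_mul fun y z => ?_)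
      rw [dist_add_right]
      exact (hf.comp (lipschitzWith_radialRetraction hρ)).dist_le_mul y z
    · exact (continuous_const.add hc).continuousOn
    · rw [hL]
      have h1 := hfK (radialRetraction ρ y)
      have h2 : (K : ℝ) * ‖radialRetraction ρ y‖ ≤ K * ρ :=
        mul_le_mul_of_nonneg_left (norm_radialRetraction_le hρ y) K.2
      have h3 := norm_add_le (f (radialRetraction ρ y)) (c t)
      have h4 := hM t ht
      linarith
    · simp [hT]
  obtain ⟨X, hX0, hX⟩ := hpl.exists_eq_forall_mem_Icc_hasDerivWithinAt₀
  have hX0 : X 0 = x := hX0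
  refine ⟨X, hX0, fun t ht => ?_⟩
  have hXt : ‖X t‖ ≤ ρ := by
    have h1 := norm_le_gronwallBound_of_hasDerivWithinAt_Icc (δ := ‖x‖) (K := K)
      (ε := ‖f 0‖ + M) hX (by rw [hX0]) (fun s hs => ?_) t ht
    · have := hmono ht.2
      linarith
    · have h1 := hfK (radialRetraction ρ (X s))
      have h2 : (K : ℝ) * ‖radialRetraction ρ (X s)‖ ≤ K * ‖X s‖ :=
        mul_le_mul_of_nonneg_left (norm_radialRetraction_le_norm hρ _) K.2
      have h3 := norm_add_le (f (radialRetraction ρ (X s))) (c s)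
      have h4 := hM s hs
      linarith
  have := hX t ht
  rwa [radialRetraction_of_norm_le hρ hXt] at this

/-- Equal controls give uniqueness; distinct ones give continuity of the endpoint in the control. -/
theorem IsTrajectory.dist_le {f : V → V} {K : NNReal} (hf : LipschitzWith K f)
    {B : W →L[ℝ] V} {T : ℝ} {x : V} {ζ ξ : C(Icc (0 : ℝ) T, W)} {X Y : ℝ → V}
    (hX : IsTrajectory f B T x ζ X) (hY : IsTrajectory f B T x ξ Y) {t : ℝ} (ht : t ∈ Icc 0 T) :
    dist (X t) (Y t) ≤ gronwallBound 0 K (‖B‖ * dist ζ ξ) t := by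
  classical
  let X' : ℝ → V := fun s => if hs : s ∈ Icc 0 T then
    (f (X s) + B (ζ ⟨s, hs⟩)) - (f (Y s) + B (ξ ⟨s, hs⟩)) else 0
  have hX' : ∀ s (hs : s ∈ Icc 0 T),
      X' s = (f (X s) + B (ζ ⟨s, hs⟩)) - (f (Y s) + B (ξ ⟨s, hs⟩)) := fun s hs => dif_pos hs
  rw [dist_eq_norm]
  refine norm_le_gronwallBound_of_hasDerivWithinAt_Icc (X := fun s => X s - Y s) (X' := X')
    (fun s hs => ?_) ?_ (fun s hs => ?_) t ht
  · rw [hX' s hs]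
    exact (hX.ode s hs).sub (hY.ode s hs)
  · simp [hX.initial, hY.initial]
  · rw [hX' s hs, add_sub_add_comm]
    refine (norm_add_le _ _).trans (add_le_add ?_ ?_)
    · rw [← dist_eq_norm, ← dist_eq_norm]
      exact hf.dist_le_mul _ _
    · rw [← map_sub]
      refine (B.le_opNorm _).trans ?_
      gcongr
      rw [← dist_eq_norm]
      exact ContinuousMap.dist_apply_le_dist _

theorem wellPosed_of_lipschitzWith [CompleteSpace V] {f : V → V} {K : NNReal}
    (hf : LipschitzWith K f) (B : W →L[ℝ] V) : WellPosed f (B : W →ₗ[ℝ] V) := by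
  intro T hT x ζ
  have hc : Continuous fun t => B (IccExtend hT.le ζ t) :=
    B.continuous.comp ζ.continuous.Icc_extend'
  obtain ⟨X, hX0, hX⟩ := exists_hasDerivWithinAt_of_lipschitzWith hf hT.le hc x
  have htraj : IsTrajectory f (B : W →ₗ[ℝ] V) T x ζ X := by
    refine ⟨hX0, fun t ht => ?_⟩
    have := hX t ht
    rwa [IccExtend_of_mem hT.le ζ ht] at this
  refine ⟨X, htraj, fun Y hY t ht => ?_⟩
  have := hY.dist_le hf htraj ht
  rw [dist_self, mul_zero, gronwallBound_ε0_δ0] at this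
  exact dist_le_zero.1 this

theorem continuous_endpointMap [CompleteSpace V] {f : V → V} {K : NNReal}
    (hf : LipschitzWith K f) (B : W →L[ℝ] V) {T : ℝ} (hT : 0 < T) (x : V) :
    Continuous (endpointMap f (B : W →ₗ[ℝ] V) T x) := by
  have hwp := wellPosed_of_lipschitzWith hf B
  refine continuous_iff_continuousAt.2 fun ζ => tendsto_iff_dist_tendsto_zero.2 ?_
  refine squeeze_zero (fun _ => dist_nonneg)
    (g := fun ξ => gronwallBound 0 K (‖B‖ * dist ξ ζ) T) (fun ξ => ?_) ?_
  · obtain ⟨X, hX, -⟩ := hwp T hT x ξ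
    obtain ⟨Y, hY, -⟩ := hwp T hT x ζ
    rw [endpointMap_eq hwp hT hX, endpointMap_eq hwp hT hY]
    exact hX.dist_le hf hY ⟨hT.le, le_rfl⟩
  · have hcont : Continuous fun ξ => gronwallBound 0 K (‖B‖ * dist ξ ζ) T :=
      (gronwallBound_continuous_ε 0 K T).comp
        (continuous_const.mul (continuous_id.dist continuous_const))
    have := hcont.tendsto ζ
    rwa [dist_self, mul_zero, gronwallBound_ε0_δ0] at this

end Ctrl

/-! ## Linear flows, observability, and Gramians -/

namespace Ctrl

open Set ContinuousLinearMap

variable {V W : Type*} [NormedAddCommGroup V] [InnerProductSpace ℝ V] [CompleteSpace V]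
  [NormedAddCommGroup W] [InnerProductSpace ℝ W] [CompleteSpace W]

/-- The linear flow `t ↦ exp (t A)`. -/
noncomputable def flow (A : V →L[ℝ] V) (t : ℝ) : V →L[ℝ] V := NormedSpace.exp (t • A)

theorem hasDerivAt_flow (A : V →L[ℝ] V) (t : ℝ) : HasDerivAt (flow A) (A * flow A t) t :=
  hasDerivAt_exp_smul_const' A t

theorem hasDerivAt_flow_apply (A : V →L[ℝ] V) (x : V) (t : ℝ) :
    HasDerivAt (fun s => flow A s x) (A (flow A t x)) t :=
  (ContinuousLinearMap.apply ℝ V x).hasFDerivAt.comp_hasDerivAt t (hasDerivAt_flow A t)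

theorem continuous_flow (A : V →L[ℝ] V) : Continuous (flow A) :=
  continuous_iff_continuousAt.2 fun t => (hasDerivAt_flow A t).continuousAt

omit [CompleteSpace V] in
theorem flow_zero (A : V →L[ℝ] V) : flow A 0 = 1 := by simp [flow]

theorem flow_mul_flow_neg (A : V →L[ℝ] V) (t : ℝ) : flow A t * flow A (-t) = 1 := by
  let _ : NormedAlgebra ℚ (V →L[ℝ] V) := NormedAlgebra.restrictScalars ℚ ℝ _
  rw [flow, flow, ← NormedSpace.exp_add_of_commute, neg_smul, add_neg_cancel, NormedSpace.exp_zero]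
  rw [neg_smul]
  exact (Commute.refl _).neg_right

theorem flow_neg_flow_apply (A : V →L[ℝ] V) (t : ℝ) (x : V) : flow A (-t) (flow A t x) = x := by
  have h := flow_mul_flow_neg A (-t)
  rw [neg_neg] at h
  exact congrArg (fun T : V →L[ℝ] V => T x) h

theorem flow_injective (A : V →L[ℝ] V) (t : ℝ) : Function.Injective (flow A t) :=
  Function.LeftInverse.injective (flow_neg_flow_apply A t)

theorem adjoint_flow (A : V →L[ℝ] V) (t : ℝ) : adjoint (flow A t) = flow (adjoint A) t := by
  rw [← star_eq_adjoint, ← star_eq_adjoint, flow, flow, NormedSpace.star_exp, star_smul,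
    star_trivial]

theorem apply_flow_comm (A : V →L[ℝ] V) (t : ℝ) (x : V) : A (flow A t x) = flow A t (A x) := by
  have h1 := hasDerivAt_flow A t
  have h2 : HasDerivAt (flow A) (flow A t * A) t := hasDerivAt_exp_smul_const A t
  exact congrArg (fun T : V →L[ℝ] V => T x) (h1.unique h2)

/-- The pair `(A, C)` is observable: no nonzero state is invisible to all the outputs `C A ^ k`. -/
def Observable (A : V →L[ℝ] V) (C : V →L[ℝ] W) : Prop :=
  ∀ x, (∀ k : ℕ, C ((A ^ k) x) = 0) → x = 0

-- Differentiating the zero output k times gives C Aᵏ e^{tA} x = 0 on the interval; observability at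
-- the midpoint and injectivity of the flow conclude.
omit [CompleteSpace W] in
theorem Observable.eq_zero_of_flow {A : V →L[ℝ] V} {C : V →L[ℝ] W} (h : Observable A C)
    {a b : ℝ} (hab : a < b) {x : V} (hx : ∀ t ∈ Ioo a b, C (flow A t x) = 0) : x = 0 := by
  have hk : ∀ k : ℕ, ∀ t ∈ Ioo a b, C ((A ^ k) (flow A t x)) = 0 := by
    intro k
    induction k with
    | zero => simpa using hx
    | succ k ih =>
      intro t ht
      have h1 : HasDerivAt (fun s => C ((A ^ k) (flow A s x))) (C ((A ^ k) (A (flow A t x)))) t :=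
        (C.comp (A ^ k)).hasFDerivAt.comp_hasDerivAt t (hasDerivAt_flow_apply A x t)
      have h2 : HasDerivAt (fun s => C ((A ^ k) (flow A s x))) 0 t :=
        (hasDerivAt_const t (0 : W)).congr_of_eventuallyEq
          (by filter_upwards [Ioo_mem_nhds ht.1 ht.2] with s hs using ih s hs)
      rw [pow_succ]
      exact h1.unique h2
  have hmem : (a + b) / 2 ∈ Ioo a b := ⟨by linarith, by linarith⟩
  refine flow_injective A ((a + b) / 2) ?_
  rw [h _ fun k => hk k _ hmem, map_zero]

/-- The Gramian `∫₀ᵗ M(s)* M(s) ds` of a path of operators. -/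
noncomputable def gramian (M : ℝ → V →L[ℝ] W) (t : ℝ) : V →L[ℝ] V :=
  ∫ s in (0 : ℝ)..t, (adjoint (M s)).comp (M s)

section Gramian

variable {M : ℝ → V →L[ℝ] W}

theorem continuous_adjoint_comp_self (hM : Continuous M) :
    Continuous fun s => (adjoint (M s)).comp (M s) :=
  ((adjoint : (V →L[ℝ] W) ≃ₗᵢ⋆[ℝ] (W →L[ℝ] V)).continuous.comp hM).clm_comp hM

theorem hasDerivAt_gramian (hM : Continuous M) (t : ℝ) :
    HasDerivAt (gramian M) ((adjoint (M t)).comp (M t)) t :=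
  ((continuous_adjoint_comp_self hM).integral_hasStrictDerivAt 0 t).hasDerivAt

theorem gramian_zero : gramian M 0 = 0 := intervalIntegral.integral_same

theorem inner_gramian (hM : Continuous M) (t : ℝ) (x y : V) :
    inner ℝ (gramian M t x) y = ∫ s in (0 : ℝ)..t, inner ℝ (M s x) (M s y) := by
  let L : (V →L[ℝ] V) →L[ℝ] ℝ := (innerSL ℝ y).comp (ContinuousLinearMap.apply ℝ V x)
  have h := L.intervalIntegral_comp_comm
    ((continuous_adjoint_comp_self hM).intervalIntegrable (μ := MeasureTheory.volume) 0 t)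
  rw [real_inner_comm]
  refine h.symm.trans (intervalIntegral.integral_congr fun s _ => ?_)
  change inner ℝ y (adjoint (M s) (M s x)) = _
  rw [adjoint_inner_right, real_inner_comm]

theorem inner_gramian_comm (hM : Continuous M) (t : ℝ) (x y : V) :
    inner ℝ (gramian M t x) y = inner ℝ (gramian M t y) x := by
  rw [inner_gramian hM, inner_gramian hM]
  exact intervalIntegral.integral_congr fun s _ => real_inner_comm _ _

theorem inner_gramian_self_pos (hM : Continuous M) {t : ℝ} (ht : 0 < t) {x : V}
    (hx : ∃ s ∈ Icc 0 t, M s x ≠ 0) : 0 < inner ℝ (gramian M t x) x := by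
  rw [inner_gramian hM]
  have hc : Continuous fun s => M s x := hM.clm_apply continuous_const
  refine intervalIntegral.integral_pos ht (hc.inner hc).continuousOn
    (fun s _ => real_inner_self_nonneg) ?_
  obtain ⟨s, hs, hne⟩ := hx
  exact ⟨s, hs, real_inner_self_pos.2 hne⟩

end Gramian

/-! ## A quadratic Lyapunov function -/

-- The norm never increases. Equality at time t would make it constant on [0, t], hence ⟨Ay, y⟩ = 0
-- and zero output along the orbit, contradicting observability.
omit [CompleteSpace W] in
theorem norm_flow_lt {A : V →L[ℝ] V} {C : V →L[ℝ] W} (hobs : Observable A C)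
    (hA : ∀ x, inner ℝ (A x) x ≤ 0) (hAC : ∀ x, inner ℝ (A x) x = 0 → C x = 0) {t : ℝ}
    (ht : 0 < t) {x : V} (hx : x ≠ 0) : ‖flow A t x‖ ^ 2 < ‖x‖ ^ 2 := by
  have hd : ∀ s, HasDerivAt (fun s => ‖flow A s x‖ ^ 2)
      (2 * inner ℝ (flow A s x) (A (flow A s x))) s := fun s =>
    (hasDerivAt_flow_apply A x s).norm_sq
  have hanti : Antitone fun s => ‖flow A s x‖ ^ 2 :=
    antitone_of_hasDerivAt_nonpos hd fun s => by
      have := hA (flow A s x)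
      rw [real_inner_comm] at this
      change _ ≤ (0 : ℝ)
      linarith
  have h0 : ‖flow A 0 x‖ ^ 2 = ‖x‖ ^ 2 := by simp [flow_zero]
  have hle : ‖flow A t x‖ ^ 2 ≤ ‖flow A 0 x‖ ^ 2 := hanti ht.le
  rw [h0] at hle
  refine lt_of_le_of_ne hle fun heq => hx ?_
  refine hobs.eq_zero_of_flow ht fun s hs => hAC _ ?_
  have hconst : HasDerivAt (fun s => ‖flow A s x‖ ^ 2) 0 s := by
    refine (hasDerivAt_const s (‖x‖ ^ 2)).congr_of_eventuallyEq ?_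
    filter_upwards [Ioo_mem_nhds hs.1 hs.2] with r hr
    have h1 : ‖flow A t x‖ ^ 2 ≤ ‖flow A r x‖ ^ 2 := hanti hr.2.le
    have h2 : ‖flow A r x‖ ^ 2 ≤ ‖flow A 0 x‖ ^ 2 := hanti hr.1.le
    linarith
  have := (hd s).unique hconst
  rw [real_inner_comm]
  linarith

/-- A commutes with its flow, so the integrand is the derivative of ‖e^{sA} x‖² / 2. -/
theorem inner_gramian_flow_apply_self (A : V →L[ℝ] V) (t : ℝ) (x : V) :
    inner ℝ (gramian (flow A) t (A x)) x = (‖flow A t x‖ ^ 2 - ‖x‖ ^ 2) / 2 := by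
  rw [inner_gramian (continuous_flow A)]
  have hd : ∀ s, HasDerivAt (fun s => ‖flow A s x‖ ^ 2 / 2)
      (inner ℝ (flow A s (A x)) (flow A s x)) s := fun s => by
    have := (hasDerivAt_flow_apply A x s).norm_sq.div_const 2
    rw [mul_div_cancel_left₀ _ two_ne_zero, apply_flow_comm, real_inner_comm] at this
    exact this
  have hc : ∀ y, Continuous fun s => flow A s y := fun y =>
    (continuous_flow A).clm_apply continuous_const
  rw [intervalIntegral.integral_eq_sub_of_hasDerivAt (fun s _ => hd s)
    (((hc _).inner (hc _)).intervalIntegrable _ _)]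
  have h0 : flow A 0 x = x := by rw [flow_zero]; rfl
  rw [h0]
  ring

omit [CompleteSpace V] in
theorem exists_neg_bound_of_inner_neg [FiniteDimensional ℝ V] (T : V →L[ℝ] V)
    (hT : ∀ x, x ≠ 0 → inner ℝ (T x) x < 0) :
    ∃ α > (0 : ℝ), ∀ x, inner ℝ (T x) x ≤ -α * ‖x‖ ^ 2 := by
  rcases subsingleton_or_nontrivial V with hV | hV
  · exact ⟨1, one_pos, fun x => by simp [Subsingleton.elim x 0]⟩
  obtain ⟨x₀, hx₀, hmax⟩ := (isCompact_sphere (0 : V) 1).exists_isMaxOn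
    (NormedSpace.sphere_nonempty.2 zero_le_one)
    (T.continuous.inner (𝕜 := ℝ) continuous_id).continuousOn
  have hx₀' : ‖x₀‖ = 1 := mem_sphere_zero_iff_norm.1 hx₀
  have hne : x₀ ≠ 0 := fun h => by simp [h] at hx₀'
  refine ⟨-inner ℝ (T x₀) x₀, neg_pos.2 (hT x₀ hne), fun x => ?_⟩
  rcases eq_or_ne x 0 with rfl | hx
  · simp
  have hnx : 0 < ‖x‖ := norm_pos_iff.2 hx
  have hmem : ‖x‖⁻¹ • x ∈ Metric.sphere (0 : V) 1 := by
    rw [mem_sphere_zero_iff_norm, norm_smul, norm_inv, norm_norm, inv_mul_cancel₀ hnx.ne']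
  have h : inner ℝ (T (‖x‖⁻¹ • x)) (‖x‖⁻¹ • x) ≤ inner ℝ (T x₀) x₀ := hmax hmem
  rw [map_smul, real_inner_smul_left, real_inner_smul_right, ← mul_assoc, ← mul_inv,
    inv_mul_le_iff₀ (by positivity)] at h
  rw [neg_neg]
  nlinarith

/-- A vector field that grows more slowly than every linear function. -/
def Sublinear (F : V → V) : Prop := ∀ ε > (0 : ℝ), ∃ C ≥ (0 : ℝ), ∀ x, ‖F x‖ ≤ ε * ‖x‖ + C

omit [CompleteSpace W] in
theorem exists_isScalarProduct_dissipative [FiniteDimensional ℝ V] {A : V →L[ℝ] V}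
    {C : V →L[ℝ] W} (hobs : Observable A C)
    (hA : ∀ x, inner ℝ (A x) x ≤ 0) (hAC : ∀ x, inner ℝ (A x) x = 0 → C x = 0) :
    ∃ g : V →ₗ[ℝ] V →ₗ[ℝ] ℝ, IsScalarProduct g ∧
      ∀ F : V → V, Sublinear F → Dissipative g fun x => A x + F x := by
  set P : V →L[ℝ] V := gramian (flow A) 1 with hP
  have hcont := continuous_flow A
  refine ⟨(innerₗ V).comp (P : V →ₗ[ℝ] V), ⟨fun u v => ?_, fun u hu => ?_⟩, fun F hF => ?_⟩
  · exact inner_gramian_comm hcont 1 u v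
  · exact inner_gramian_self_pos hcont one_pos ⟨0, ⟨le_rfl, zero_le_one⟩, by simpa [flow_zero]⟩
  obtain ⟨α, hα, hneg⟩ := exists_neg_bound_of_inner_neg (P.comp A) fun x hx => by
    change inner ℝ (P (A x)) x < 0
    rw [hP, inner_gramian_flow_apply_self]
    have := norm_flow_lt hobs hA hAC one_pos hx
    linarith
  have hP1 : 0 < ‖P‖ + 1 := by positivity
  -- F then costs α/4 ‖y‖² plus a linear term, which Young's inequality bounds by another α/4 ‖y‖²
  -- and a constant. The remaining α/2 ‖y‖² dominates a multiple of ⟨Py, y⟩.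
  obtain ⟨c, hc, hFc⟩ := hF (α / (4 * (‖P‖ + 1))) (by positivity)
  refine ⟨α / (2 * (‖P‖ + 1)), by positivity, ((‖P‖ + 1) * c) ^ 2 / α + 1, by positivity,
    fun y => ?_⟩
  change inner ℝ (P (A y + F y)) y ≤ -(α / (2 * (‖P‖ + 1))) * inner ℝ (P y) y + _
  have h1 : inner ℝ (P (A y)) y ≤ -α * ‖y‖ ^ 2 := hneg y
  have h2 : inner ℝ (P (F y)) y ≤ (‖P‖ + 1) * (α / (4 * (‖P‖ + 1)) * ‖y‖ + c) * ‖y‖ := by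
    refine (real_inner_le_norm _ _).trans ?_
    gcongr
    refine (P.le_opNorm _).trans ?_
    gcongr
    · linarith
    · exact hFc y
  have h3 : inner ℝ (P y) y ≤ (‖P‖ + 1) * ‖y‖ ^ 2 := by
    refine (real_inner_le_norm _ _).trans ?_
    rw [sq, ← mul_assoc]
    gcongr
    refine (P.le_opNorm _).trans ?_
    gcongr
    linarith
  have h4 : (‖P‖ + 1) * (α / (4 * (‖P‖ + 1)) * ‖y‖ + c) * ‖y‖
      = α / 4 * ‖y‖ ^ 2 + (‖P‖ + 1) * c * ‖y‖ := by field_simp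
  have h5 : (‖P‖ + 1) * c * ‖y‖ ≤ α / 4 * ‖y‖ ^ 2 + ((‖P‖ + 1) * c) ^ 2 / α := by
    have h : 0 ≤ (α / 2 * ‖y‖ - (‖P‖ + 1) * c) ^ 2 / α := by positivity
    have h' : (α / 2 * ‖y‖ - (‖P‖ + 1) * c) ^ 2 / α
      = α / 4 * ‖y‖ ^ 2 + ((‖P‖ + 1) * c) ^ 2 / α - (‖P‖ + 1) * c * ‖y‖ := by
      field_simp; ring
    linarith
  have h6 : α / (2 * (‖P‖ + 1)) * inner ℝ (P y) y ≤ α / 2 * ‖y‖ ^ 2 := by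
    calc α / (2 * (‖P‖ + 1)) * inner ℝ (P y) y
        ≤ α / (2 * (‖P‖ + 1)) * ((‖P‖ + 1) * ‖y‖ ^ 2) := by gcongr
      _ = α / 2 * ‖y‖ ^ 2 := by field_simp
  rw [map_add, inner_add_left]
  linarith

/-! ## Controllability of sublinear perturbations -/

/-- For a controllable linear system, a family of controls `u · z`, linear in `z`, steering the
origin to `z` in time `1` along the trajectories `Y · z`. -/
theorem exists_linear_control [FiniteDimensional ℝ V] {A : V →L[ℝ] V} {B : W →L[ℝ] V}
    (h : Observable (adjoint A) (adjoint B)) :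
    ∃ (u : ℝ → V →L[ℝ] W) (Y : ℝ → V →L[ℝ] V), Continuous u ∧ Y 0 = 0 ∧ Y 1 = 1 ∧
      ∀ t, HasDerivAt Y (A.comp (Y t) + B.comp (u t)) t := by
  -- The classical Gramian control: u(t) = B* e^{-tA*} N, with N inverse to e^A ∫₀¹
  -- e^{-sA}BB*e^{-sA*} ds. The reversed time explains the interval (-1, 0) below.
  let M : ℝ → V →L[ℝ] W := fun s => (adjoint B).comp (flow (adjoint A) (-s))
  have hM : Continuous M :=
    continuous_const.clm_comp ((continuous_flow _).comp continuous_neg)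
  have hinj : Function.Injective (flow A 1 * gramian M 1 : V →L[ℝ] V) := by
    refine (injective_iff_map_eq_zero _).2 fun w hw => ?_
    have hw' : gramian M 1 w = 0 := flow_injective A 1 (by rw [map_zero]; exact hw)
    by_contra hne
    refine hne (h.eq_zero_of_flow (a := -1) (b := 0) (by norm_num) fun t ht => ?_)
    by_contra ht'
    have hpos := inner_gramian_self_pos hM one_pos (x := w)
      ⟨-t, ⟨by linarith [ht.2], by linarith [ht.1]⟩, by simpa [M] using ht'⟩
    rw [hw', inner_zero_left] at hpos
    exact lt_irrefl _ hpos
  let N : V →L[ℝ] V := LinearMap.toContinuousLinearMap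
    (LinearEquiv.ofInjectiveEndo (flow A 1 * gramian M 1 : V →L[ℝ] V).toLinearMap hinj).symm.toLinearMap
  have hN : (flow A 1 * gramian M 1).comp N = 1 := by
    ext x
    exact (LinearEquiv.ofInjectiveEndo (flow A 1 * gramian M 1 : V →L[ℝ] V).toLinearMap
      hinj).apply_symm_apply x
  refine ⟨fun t => (M t).comp N, fun t => (flow A t * gramian M t).comp N,
    hM.clm_comp continuous_const, ?_, hN, fun t => ?_⟩
  · simp [gramian_zero]
  · have h1 : HasDerivAt (fun t => (flow A t * gramian M t).comp N)
        ((A * flow A t * gramian M t + flow A t * (adjoint (M t)).comp (M t)).comp N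
          + (flow A t * gramian M t).comp 0) t :=
      ((hasDerivAt_flow A t).mul (hasDerivAt_gramian hM t)).clm_comp (hasDerivAt_const t N)
    convert h1 using 1
    have h2 : flow A t * (adjoint (M t)).comp (M t) = B.comp (M t) := by
      have h3 : adjoint (M t) = (flow A (-t)).comp B := by
        simp only [M]
        rw [adjoint_comp, adjoint_adjoint, adjoint_flow, adjoint_adjoint]
      rw [h3]
      change (flow A t * flow A (-t)).comp (B.comp (M t)) = _
      rw [flow_mul_flow_neg]
      rfl
    rw [h2, comp_zero, add_zero, add_comp]
    rfl

end Ctrl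

namespace Ctrl

open Set ContinuousLinearMap

variable {V W : Type*} [NormedAddCommGroup V] [InnerProductSpace ℝ V] [FiniteDimensional ℝ V]
  [NormedAddCommGroup W] [InnerProductSpace ℝ W] [CompleteSpace W]

/-- For a controllable linear system with a sublinear perturbation, there is a continuous family
of controls `ζ z` whose endpoint map is uniformly close to `z` on large balls. -/
theorem exists_control_family {A : V →L[ℝ] V} {B : W →L[ℝ] V}
    (h : Observable (adjoint A) (adjoint B)) {F : V → V} (hF : Sublinear F)
    (hwp : WellPosed (fun x => A x + F x) (B : W →ₗ[ℝ] V)) :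
    ∃ ζ : V → C(Icc (0 : ℝ) 1, W), Continuous ζ ∧ ∀ η > (0 : ℝ), ∀ R₀ : ℝ, 0 ≤ R₀ →
      ∀ᶠ R in atTop, ∀ x, ‖x‖ ≤ R₀ → ∀ z, ‖z‖ ≤ R →
        ‖endpointMap (fun x => A x + F x) (B : W →ₗ[ℝ] V) 1 x (ζ z) - z‖ ≤ η * R := by
  obtain ⟨u, Y, hu, hY0, hY1, hY⟩ := exists_linear_control h
  have hucont : Continuous fun p : V × Icc (0 : ℝ) 1 => u p.2 p.1 :=
    (hu.comp (continuous_subtype_val.comp continuous_snd)).clm_apply continuous_fst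
  refine ⟨fun z => ⟨fun t => u t z, hucont.comp (Continuous.prodMk_right z)⟩,
    ContinuousMap.continuous_of_continuous_uncurry _ hucont, fun η hη R₀ hR₀ => ?_⟩
  have hYc : Continuous Y := continuous_iff_continuousAt.2 fun t => (hY t).continuousAt
  obtain ⟨m, hm⟩ := (isCompact_Icc (a := (0 : ℝ)) (b := 1)).exists_bound_of_continuousOn
    hYc.continuousOn
  have hm0 : 0 ≤ m := (norm_nonneg _).trans (hm 0 ⟨le_rfl, zero_le_one⟩)
  set κ : ℝ := ‖A‖ + 1 with hκ
  have hκ1 : 1 ≤ κ := by simp [hκ]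
  have hκ0 : 0 < κ := by linarith
  set e : ℝ := Real.exp κ with he
  have he0 : 0 < e := Real.exp_pos κ
  -- The bound 1 lets κ absorb the feedback of F on the error; the other keeps the part growing with
  -- R below ηR/2. Taking R large puts the fixed part R₀ + c below ηR/2 too.
  set ε : ℝ := min 1 (η / (2 * e * (m + 1))) with hε
  have hε0 : 0 < ε := by positivity
  obtain ⟨c, hc, hFc⟩ := hF ε hε0
  filter_upwards [eventually_ge_atTop (2 * e * (R₀ + c) / η)] with R hR x hx z hz
  have hR0 : 0 ≤ R := (norm_nonneg z).trans hz
  obtain ⟨X, hX, -⟩ := hwp 1 one_pos x ⟨fun t => u t z, hucont.comp (Continuous.prodMk_right z)⟩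
  rw [endpointMap_eq hwp one_pos hX]
  have hYz : ∀ t, HasDerivAt (fun t => Y t z) (A (Y t z) + B (u t z)) t := fun t =>
    (ContinuousLinearMap.apply ℝ V z).hasFDerivAt.comp_hasDerivAt t (hY t)
  -- The control cancels in the difference, which obeys the linear equation forced by F(X) alone.
  have hgr : ‖X 1 - Y 1 z‖ ≤ gronwallBound R₀ κ (ε * (m * R) + c) 1 := by
    refine norm_le_gronwallBound_of_hasDerivWithinAt_Icc (X := fun t => X t - Y t z)
      (X' := fun t => A (X t - Y t z) + F (X t)) (fun t ht => ?_) ?_ (fun t ht => ?_) 1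
      ⟨zero_le_one, le_rfl⟩
    · have h1 : A (X t - Y t z) + F (X t)
          = A (X t) + F (X t) + B (u t z) - (A (Y t z) + B (u t z)) := by
        rw [map_sub]; abel
      rw [h1]
      exact (hX.ode t ht).sub (hYz t).hasDerivWithinAt
    · simpa [hX.initial, hY0] using hx
    · have h1 : ‖Y t z‖ ≤ m * R := by
        refine ((Y t).le_opNorm z).trans ?_
        have := hm t ht
        gcongr
      have h2 : ‖X t‖ ≤ ‖X t - Y t z‖ + ‖Y t z‖ := norm_le_norm_sub_add _ _
      have h3 := A.le_opNorm (X t - Y t z)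
      have h4 : ε * ‖X t‖ ≤ 1 * ‖X t - Y t z‖ + ε * (m * R) := by
        calc ε * ‖X t‖ ≤ ε * (‖X t - Y t z‖ + m * R) := by gcongr; linarith
          _ = ε * ‖X t - Y t z‖ + ε * (m * R) := mul_add _ _ _
          _ ≤ 1 * ‖X t - Y t z‖ + ε * (m * R) := by gcongr; exact min_le_left _ _
      have h5 := hFc (X t)
      have h6 := norm_add_le (A (X t - Y t z)) (F (X t))
      rw [hκ, add_mul]
      linarith
  rw [hY1] at hgr
  refine (hgr : ‖X 1 - z‖ ≤ _).trans ?_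
  rw [gronwallBound_of_K_ne_0 hκ0.ne']
  beta_reduce
  rw [mul_one]
  change R₀ * e + (ε * (m * R) + c) / κ * (e - 1) ≤ η * R
  have hq : 0 ≤ ε * (m * R) + c := by positivity
  have h1 : (ε * (m * R) + c) / κ * (e - 1) ≤ (ε * (m * R) + c) * e := by
    refine mul_le_mul (div_le_self hq hκ1) (by linarith) ?_ hq
    have := Real.one_le_exp hκ0.le
    linarith
  have h2 : ε * (2 * e * (m + 1)) ≤ η := by
    rw [← le_div_iff₀ (by positivity)]
    exact min_le_right _ _
  have h3 : e * (R₀ + c) ≤ η / 2 * R := by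
    rw [div_le_iff₀ hη] at hR
    linarith
  have h4 : ε * (m * R) * e ≤ η / 2 * R := by
    have h5 : ε * m * e ≤ η / 2 := by
      have : 0 ≤ ε * e := by positivity
      linarith
    calc ε * (m * R) * e = ε * m * e * R := by ring
      _ ≤ η / 2 * R := by gcongr
  linarith

theorem controllable_of_sublinear {A : V →L[ℝ] V} {B : W →L[ℝ] V}
    (h : Observable (adjoint A) (adjoint B)) {F : V → V} (hF : Sublinear F) {K : NNReal}
    (hlip : LipschitzWith K fun x => A x + F x) (xhat : V) :
    ApproxControllableTo (fun x => A x + F x) (B : W →ₗ[ℝ] V) xhat ∧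
      SolidlyControllableFrom (fun x => A x + F x) (B : W →ₗ[ℝ] V) xhat := by
  have hwp := wellPosed_of_lipschitzWith hlip B
  obtain ⟨ζ, hζ, hclose⟩ := exists_control_family h hF hwp
  constructor
  · intro ε hε R₀ hR₀
    -- R/8 for the endpoint error and R/8 for `xhat` make up the R/4 that Brouwer allows.
    obtain ⟨R, hend, hR, hRx⟩ := ((hclose (1 / 8) (by norm_num) R₀ hR₀.le).and
      ((eventually_gt_atTop 0).and (eventually_ge_atTop (8 * ‖xhat‖)))).exists
    refine ⟨1, one_pos, fun x hx => ?_⟩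
    obtain ⟨z, -, hz⟩ := Brouwer.exists_zero_of_norm_sub_le hR
      (φ := fun z => endpointMap (fun x => A x + F x) (B : W →ₗ[ℝ] V) 1 x (ζ z) - xhat)
      (((continuous_endpointMap hlip B one_pos x).comp hζ).sub continuous_const).continuousOn
      fun z hz => by
        have h1 := hend x hx z hz
        rw [sub_right_comm]
        have h2 := norm_sub_le
          (endpointMap (fun x => A x + F x) (B : W →ₗ[ℝ] V) 1 x (ζ z) - z) xhat
        linarith
    exact ⟨ζ z, by rwa [hz, norm_zero]⟩
  -- R/16 for the endpoint error, R/16 for Φ and R/8 for the target y again total R/4.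
  · obtain ⟨R, hend, hR⟩ := ((hclose (1 / 16) (by norm_num) ‖xhat‖ (norm_nonneg _)).and
      (eventually_gt_atTop 0)).exists
    refine ⟨R / 16, by positivity, 1, one_pos, ζ '' Metric.closedBall 0 R,
      (isCompact_closedBall 0 R).image hζ, 0, R / 8, by positivity, fun Φ hΦ hclose y hy => ?_⟩
    rw [mem_closedBall_zero_iff] at hy
    let ζ' : Metric.closedBall (0 : V) R → ζ '' Metric.closedBall 0 R := fun z =>
      ⟨ζ z, mem_image_of_mem ζ z.2⟩
    have hζ' : Continuous ζ' := (hζ.comp continuous_subtype_val).subtype_mk _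
    have hr : ∀ z : V, radialRetraction R z ∈ Metric.closedBall (0 : V) R := fun z =>
      mem_closedBall_zero_iff.2 (norm_radialRetraction_le hR z)
    let φ : V → V := fun z => Φ (ζ' ⟨radialRetraction R z, hr z⟩) - y
    have hφ : Continuous φ := (hΦ.comp (hζ'.comp
      ((lipschitzWith_radialRetraction hR).continuous.subtype_mk hr))).sub continuous_const
    obtain ⟨z, -, hz0⟩ := Brouwer.exists_zero_of_norm_sub_le hR hφ.continuousOn fun z hz => by
      have h1 := hend xhat le_rfl z hz
      have h2 := hclose (ζ' ⟨radialRetraction R z, hr z⟩)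
      have h3 : ((ζ' ⟨radialRetraction R z, hr z⟩ : ζ '' Metric.closedBall 0 R) :
          C(Icc (0 : ℝ) 1, W)) = ζ z := by
        simp only [ζ', radialRetraction_of_norm_le hR hz]
      rw [h3] at h2
      set s := endpointMap (fun x => A x + F x) (B : W →ₗ[ℝ] V) 1 xhat (ζ z)
      have h4 : φ z - z = (Φ (ζ' ⟨radialRetraction R z, hr z⟩) - s) + (s - z) - y := by
        simp only [φ]; abel
      rw [h4]
      have h5 := norm_sub_le
        ((Φ (ζ' ⟨radialRetraction R z, hr z⟩) - s) + (s - z)) y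
      have h6 := norm_add_le (Φ (ζ' ⟨radialRetraction R z, hr z⟩) - s) (s - z)
      linarith
    exact ⟨_, sub_eq_zero.1 hz0⟩

end Ctrl

/-! ## Matrices of the network -/

namespace Network

variable {I : Type*} [Fintype I] [DecidableEq I] {J : Finset I}

omit [Fintype I] in
theorem sum_ite_eq_zero_of_notMem (c : J → ℝ) {i : I} (hi : i ∉ J) :
    (∑ j : J, if (j : I) = i then c j else 0) = 0 :=
  Finset.sum_eq_zero fun j _ => if_neg fun h : (j : I) = i => hi (h ▸ j.2)

theorem sum_smul_iota_transpose_mulVec (c : J → ℝ) (p : I → ℝ) :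
    (∑ j, c j • (iota j)ᵀ) *ᵥ p = fun j => c j * p j := by
  ext j
  rw [Matrix.sum_mulVec, Finset.sum_apply, Finset.sum_eq_single j]
  · simp [iota, Matrix.transpose_single, Matrix.single_mulVec]
  · intro k _ hk
    simp [iota, Matrix.transpose_single, Matrix.single_mulVec,
      Function.update_of_ne hk.symm]
  · simp

theorem sum_smul_iota_transpose_mul_iota (c : J → ℝ) :
    ∑ j, c j • ((iota j)ᵀ * iota j) = Matrix.diagonal c := by
  ext k l
  rw [Matrix.sum_apply, Finset.sum_eq_single k]
  · by_cases h : k = l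
    · subst h; simp [iota, Matrix.transpose_single]
    · simp [iota, Matrix.transpose_single, Matrix.diagonal, h]
  · intro j _ hj
    simp [iota, Matrix.transpose_single, hj]
  · simp

omit [Fintype I] in
theorem sum_smul_iota_mul_iota_transpose (c : J → ℝ) :
    ∑ j, c j • (iota j * (iota j)ᵀ)
      = Matrix.diagonal fun i => ∑ j : J, if (j : I) = i then c j else 0 := by
  ext k l
  rw [Matrix.sum_apply]
  by_cases h : k = l
  · subst h
    rw [Matrix.diagonal_apply_eq]
    refine Finset.sum_congr rfl fun j _ => ?_
    simp [iota, Matrix.transpose_single, Matrix.single_apply]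
  · rw [Matrix.diagonal_apply_ne _ h]
    refine Finset.sum_eq_zero fun j _ => ?_
    simp only [iota, Matrix.transpose_single, Matrix.single_mul_single_same, Matrix.smul_apply,
      Matrix.single_apply]
    rw [if_neg fun hj => h (hj.1.symm.trans hj.2), smul_zero]

theorem driftMatrix_mulVec (γ lam : J → ℝ) (ωt : Matrix I I ℝ) (r : J → ℝ) (p s : I → ℝ) :
    driftMatrix γ lam ωt *ᵥ Sum.elim r (Sum.elim p s)
      = Sum.elim (fun j => -(γ j * r j) + lam j * p j)
          (Sum.elim (-((∑ j, lam j • iota j) *ᵥ r) - ωtᵀ *ᵥ s) (ωt *ᵥ p)) := by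
  rw [driftMatrix, sum_smul_iota_transpose_mul_iota, Matrix.fromBlocks_mulVec]
  simp only [Sum.elim_comp_inl, Sum.elim_comp_inr, Matrix.fromCols_mulVec_sumElim,
    Matrix.fromRows_mulVec, Matrix.fromBlocks_mulVec, sum_smul_iota_transpose_mulVec,
    Matrix.neg_mulVec, Matrix.zero_mulVec, add_zero, zero_add]
  ext (j | i | i) <;> simp [Matrix.mulVec_diagonal, sub_eq_add_neg]

/-- The adjoint system belongs to the same family, so one observability argument also yields
controllability. -/
theorem driftMatrix_transpose (γ lam : J → ℝ) (ωt : Matrix I I ℝ) :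
    (driftMatrix γ lam ωt)ᵀ = driftMatrix γ (-lam) (-ωt) := by
  simp only [driftMatrix, Matrix.fromBlocks_transpose, Matrix.transpose_fromRows,
    Matrix.transpose_fromCols, Matrix.transpose_neg, Matrix.transpose_sum, Matrix.transpose_smul,
    Matrix.transpose_mul, Matrix.transpose_transpose, Matrix.transpose_zero, Pi.neg_apply,
    neg_smul, Finset.sum_neg_distrib, neg_neg]

omit [Fintype I] [DecidableEq I] in
theorem exists_sum_elim_eq (x : J ⊕ I ⊕ I → ℝ) :
    ∃ (r : J → ℝ) (p s : I → ℝ), x = Sum.elim r (Sum.elim p s) :=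
  ⟨x ∘ Sum.inl, x ∘ Sum.inr ∘ Sum.inl, x ∘ Sum.inr ∘ Sum.inr, by ext (j | i | i) <;> rfl⟩

/-- Everything except the friction block is skew-symmetric. -/
theorem dotProduct_driftMatrix_mulVec (γ lam : J → ℝ) (ωt : Matrix I I ℝ) (r : J → ℝ)
    (p s : I → ℝ) :
    Sum.elim r (Sum.elim p s) ⬝ᵥ (driftMatrix γ lam ωt *ᵥ Sum.elim r (Sum.elim p s))
      = -∑ j, γ j * r j ^ 2 := by
  have h1 : p ⬝ᵥ ((∑ j, lam j • iota j) *ᵥ r) = ∑ j, r j * (lam j * p j) := by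
    have h : (∑ j, lam j • iota j : Matrix I J ℝ)ᵀ = ∑ j, lam j • (iota j)ᵀ := by
      simp [Matrix.transpose_sum]
    rw [Matrix.dotProduct_mulVec, ← Matrix.mulVec_transpose, h, sum_smul_iota_transpose_mulVec,
      dotProduct_comm]
    rfl
  have h2 : p ⬝ᵥ (ωtᵀ *ᵥ s) = s ⬝ᵥ (ωt *ᵥ p) := by
    rw [Matrix.dotProduct_mulVec, Matrix.vecMul_transpose, dotProduct_comm]
  rw [driftMatrix_mulVec, sumElim_dotProduct_sumElim, sumElim_dotProduct_sumElim,
    dotProduct_sub, dotProduct_neg, h1, h2]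
  simp only [dotProduct, mul_add, Finset.sum_add_distrib, ← Finset.sum_neg_distrib]
  have h3 : ∀ j, r j * -(γ j * r j) = -(γ j * r j ^ 2) := fun j => by ring
  simp only [h3, Finset.sum_neg_distrib]
  ring

/-- Under the Kalman condition a momentum all of whose iterates vanish on `J` is zero. -/
theorem Kalman.eq_zero {Ω : Matrix I I ℝ} (hΩ : Ωᵀ = Ω)
    (hK : Kalman Ω (∑ j : J, iota j * (iota j)ᵀ)) {p : I → ℝ}
    (hp : ∀ k : ℕ, ∀ j : J, ((Ω ^ k) *ᵥ p) j = 0) : p = 0 := by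
  obtain ⟨y, hy⟩ := hK p
  have hproj : ∑ j : J, iota j * (iota j)ᵀ
      = Matrix.diagonal fun i : I => ∑ j : J, if (j : I) = i then (1 : ℝ) else 0 := by
    simpa using sum_smul_iota_mul_iota_transpose (fun _ : J => (1 : ℝ))
  -- Expand one factor by Kalman and move Ωᵏ to the other: Ωᵏp is paired with a vector supported on
  -- J.
  have hpp : p ⬝ᵥ p = 0 := by
    nth_rw 2 [hy]
    rw [dotProduct_sum]
    refine Finset.sum_eq_zero fun k _ => ?_
    rw [← Matrix.mulVec_mulVec, Matrix.dotProduct_mulVec, ← Matrix.mulVec_transpose,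
      Matrix.transpose_pow, hΩ, hproj, dotProduct]
    refine Finset.sum_eq_zero fun i _ => ?_
    rw [Matrix.mulVec_diagonal]
    by_cases hi : i ∈ J
    · rw [hp k ⟨i, hi⟩, zero_mul]
    · rw [sum_ite_eq_zero_of_notMem (fun _ => 1) hi, zero_mul, mul_zero]
  exact dotProduct_self_eq_zero.1 hpp

/-- The unobservable states `S` are A-invariant and have r = 0. Applying A to (0, p, s) gives (λp,
-ω̃*s, ω̃p), so p vanishes on J. A second application turns p into -ω̃*ω̃p = -Ωp, since λ²ιι* kills
vectors vanishing on J. Hence every Ωᵏp vanishes on J, and p = 0 by Kalman. -/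
theorem eq_zero_of_driftMatrix_pow {γ lam : J → ℝ} (hlam : ∀ j, lam j ≠ 0)
    {Ω ωt : Matrix I I ℝ} (hΩ : Ωᵀ = Ω)
    (hωt : ωtᵀ * ωt = Ω - ∑ j, lam j ^ 2 • (iota j * (iota j)ᵀ)) (hdet : IsUnit ωt.det)
    (hK : Kalman Ω (∑ j : J, iota j * (iota j)ᵀ)) {x : J ⊕ I ⊕ I → ℝ}
    (hx : ∀ (k : ℕ) (j : J), ((driftMatrix γ lam ωt ^ k) *ᵥ x) (Sum.inl j) = 0) : x = 0 := by
  set A := driftMatrix γ lam ωt with hA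
  let S : (J ⊕ I ⊕ I → ℝ) → Prop := fun x => ∀ (k : ℕ) (j : J), ((A ^ k) *ᵥ x) (Sum.inl j) = 0
  have hS : ∀ {x}, S x → S (A *ᵥ x) := by
    intro x hx k j
    rw [Matrix.mulVec_mulVec, ← pow_succ]
    exact hx _ _
  have hr : ∀ {r p s}, S (Sum.elim r (Sum.elim p s)) → r = 0 := by
    intro r p s h
    ext j
    simpa using h 0 j
  have hstep : ∀ {r p s}, S (Sum.elim r (Sum.elim p s)) →
      S (Sum.elim (fun j => lam j * p j) (Sum.elim (-(ωtᵀ *ᵥ s)) (ωt *ᵥ p))) := by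
    intro r p s h
    have h' := hS h
    rw [hr h, hA, driftMatrix_mulVec] at h'
    simpa using h'
  have hpJ : ∀ {r p s}, S (Sum.elim r (Sum.elim p s)) → ∀ j : J, p j = 0 := by
    intro r p s h j
    have := congrFun (hr (hstep h)) j
    exact (mul_eq_zero.1 this).resolve_left (hlam j)
  have hΩp : ∀ {p : I → ℝ}, (∀ j : J, p j = 0) → ωtᵀ *ᵥ (ωt *ᵥ p) = Ω *ᵥ p := by
    intro p hp
    rw [Matrix.mulVec_mulVec, hωt, Matrix.sub_mulVec, sum_smul_iota_mul_iota_transpose, sub_eq_self]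
    ext i
    rw [Matrix.mulVec_diagonal]
    by_cases hi : i ∈ J
    · rw [hp ⟨i, hi⟩, mul_zero]; rfl
    · rw [sum_ite_eq_zero_of_notMem _ hi, zero_mul]
      rfl
  have hpow : ∀ k : ℕ, ∀ {r p s}, S (Sum.elim r (Sum.elim p s)) →
      ∀ j : J, ((Ω ^ k) *ᵥ p) j = 0 := by
    intro k
    induction k with
    | zero => intro r p s h j; simpa using hpJ h j
    | succ k ih =>
      intro r p s h j
      have h2 := hstep (hstep h)
      rw [hΩp (hpJ h)] at h2
      have := ih h2 j
      rw [pow_succ, ← Matrix.mulVec_mulVec]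
      rw [Matrix.mulVec_neg, Pi.neg_apply, neg_eq_zero] at this
      exact this
  have hp : ∀ {r p s}, S (Sum.elim r (Sum.elim p s)) → p = 0 := fun h =>
    hK.eq_zero hΩ fun k j => hpow k h j
  obtain ⟨r, p, s, rfl⟩ := exists_sum_elim_eq x
  have hs : s = 0 := by
    -- -ω̃*s is the momentum of the next state, which is again unobservable.
    have h1 : ωtᵀ *ᵥ s = 0 := neg_eq_zero.1 (hp (hstep (r := r) hx))
    refine Matrix.eq_zero_of_mulVec_eq_zero ?_ h1
    rw [Matrix.det_transpose]
    exact hdet.ne_zero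
  rw [hr hx, hp hx, hs]
  ext (j | i | i) <;> rfl

end Network

/-! ### Existence of ω̃ for small λ. -/

section SquareRoot

open scoped MatrixOrder

theorem exists_transpose_mul_self_eq {n : Type*} [Fintype n] [DecidableEq n] {Q : Matrix n n ℝ}
    (hQ : Q.PosSemidef) : ∃ X : Matrix n n ℝ, Xᵀ * X = Q := by
  obtain ⟨X, hX, -, h⟩ := CFC.exists_sqrt_of_isSelfAdjoint_of_quasispectrumRestricts
    hQ.isHermitian (QuasispectrumRestricts.nnreal_of_nonneg hQ.nonneg)
  refine ⟨X, ?_⟩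
  have h' : Xᵀ = X := by
    have := hX.star_eq
    rwa [Matrix.star_eq_conjTranspose, Matrix.conjTranspose_eq_transpose_of_trivial] at this
  rw [h', ← h]

end SquareRoot

namespace Network

variable {I : Type*} [Fintype I] [DecidableEq I] {J : Finset I}

/-- Subtracting `λ² ι ι*` from `ω* ω` preserves positive definiteness for small `λ`. -/
theorem exists_forall_posDef {ω : Matrix I I ℝ} (hω : IsUnit ω.det) (J : Finset I) :
    ∃ lam₀ > (0 : ℝ), ∀ lam : J → ℝ, (∀ j, 0 < lam j ∧ lam j ≤ lam₀) →
      (ωᵀ * ω - ∑ j, lam j ^ 2 • (iota j * (iota j)ᵀ)).PosDef := by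
  -- Squared Frobenius norm of ω⁻¹, so |x|² ≤ K |ωx|² by Cauchy–Schwarz. The choice λ₀ = 1/(K + 2)
  -- gives λ₀²K < 1.
  set K : ℝ := ∑ i, ∑ k, ω⁻¹ i k ^ 2 with hKdef
  have hK0 : 0 ≤ K := Finset.sum_nonneg fun i _ => Finset.sum_nonneg fun k _ => sq_nonneg _
  have hK : ∀ x : I → ℝ, x ⬝ᵥ x ≤ K * ((ω *ᵥ x) ⬝ᵥ (ω *ᵥ x)) := by
    intro x
    have hx : x = ω⁻¹ *ᵥ (ω *ᵥ x) := by
      rw [Matrix.mulVec_mulVec, Matrix.nonsing_inv_mul _ hω, Matrix.one_mulVec]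
    set v := ω *ᵥ x
    have hv : v ⬝ᵥ v = ∑ k, v k ^ 2 := Finset.sum_congr rfl fun k _ => (sq _).symm
    have hx' : x ⬝ᵥ x = ∑ i, x i ^ 2 := Finset.sum_congr rfl fun k _ => (sq _).symm
    rw [hx', hKdef, Finset.sum_mul, hv]
    refine Finset.sum_le_sum fun i _ => ?_
    rw [hx]
    exact Finset.sum_mul_sq_le_sq_mul_sq _ _ _
  refine ⟨1 / (K + 2), by positivity, fun lam hlam => ?_⟩
  rw [sum_smul_iota_mul_iota_transpose]
  refine Matrix.PosDef.of_dotProduct_mulVec_pos ?_ fun x hx => ?_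
  · rw [Matrix.IsHermitian, Matrix.conjTranspose_eq_transpose_of_trivial, Matrix.transpose_sub,
      Matrix.transpose_mul, Matrix.transpose_transpose, Matrix.diagonal_transpose]
  · have hd : ∀ i : I, (∑ j : J, if (j : I) = i then lam j ^ 2 else 0) ≤ (1 / (K + 2)) ^ 2 := by
      intro i
      by_cases hi : i ∈ J
      · rw [Finset.sum_eq_single ⟨i, hi⟩]
        · rw [if_pos rfl]
          exact pow_le_pow_left₀ (hlam _).1.le (hlam _).2 2
        · intro j _ hj
          exact if_neg fun h => hj (Subtype.ext h)
        · simp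
      · rw [sum_ite_eq_zero_of_notMem _ hi]
        positivity
    have hωx : ω *ᵥ x ≠ 0 := fun h =>
      hx (Matrix.eq_zero_of_mulVec_eq_zero hω.ne_zero h)
    have hpos : 0 < (ω *ᵥ x) ⬝ᵥ (ω *ᵥ x) := by
      refine lt_of_le_of_ne (Finset.sum_nonneg fun i _ => mul_self_nonneg _) fun h => hωx ?_
      exact dotProduct_self_eq_zero.1 h.symm
    have h1 : x ⬝ᵥ ((ωᵀ * ω) *ᵥ x) = (ω *ᵥ x) ⬝ᵥ (ω *ᵥ x) := by
      rw [← Matrix.mulVec_mulVec, Matrix.dotProduct_mulVec, Matrix.vecMul_transpose]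
    have h2 : x ⬝ᵥ (Matrix.diagonal (fun i => ∑ j : J, if (j : I) = i then lam j ^ 2 else 0) *ᵥ x)
        ≤ (1 / (K + 2)) ^ 2 * (x ⬝ᵥ x) := by
      simp only [dotProduct, Matrix.mulVec_diagonal]
      rw [Finset.mul_sum]
      refine Finset.sum_le_sum fun i _ => ?_
      have := mul_le_mul_of_nonneg_right (hd i) (mul_self_nonneg (x i))
      linarith
    have h3 : (1 / (K + 2)) ^ 2 * K < 1 := by
      rw [div_pow, one_pow, one_div_mul_eq_div, div_lt_one (by positivity)]
      nlinarith
    have h4 : (1 / (K + 2)) ^ 2 * (x ⬝ᵥ x)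
        ≤ (1 / (K + 2)) ^ 2 * (K * ((ω *ᵥ x) ⬝ᵥ (ω *ᵥ x))) :=
      mul_le_mul_of_nonneg_left (hK x) (by positivity)
    rw [star_trivial, Matrix.sub_mulVec, dotProduct_sub, h1]
    nlinarith

end Network

/-! ### Sublinear growth of the force. -/

namespace Ctrl

variable {V E : Type*} [NormedAddCommGroup V] [InnerProductSpace ℝ V]
  [NormedAddCommGroup E] [InnerProductSpace ℝ E]

theorem Sublinear.comp_continuousLinearMap {G : E → E} (hG : Sublinear G) (P : V →L[ℝ] E)
    (L : E →L[ℝ] V) : Sublinear fun x => L (G (P x)) := by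
  intro ε hε
  have hq : 0 < ‖L‖ * ‖P‖ + 1 := by positivity
  obtain ⟨C, hC, h⟩ := hG (ε / (‖L‖ * ‖P‖ + 1)) (by positivity)
  refine ⟨‖L‖ * C, by positivity, fun x => ?_⟩
  calc ‖L (G (P x))‖ ≤ ‖L‖ * ‖G (P x)‖ := L.le_opNorm _
    _ ≤ ‖L‖ * (ε / (‖L‖ * ‖P‖ + 1) * (‖P‖ * ‖x‖) + C) := by
        gcongr
        refine (h _).trans ?_
        gcongr
        exact P.le_opNorm x
    _ = ε * (‖L‖ * ‖P‖ / (‖L‖ * ‖P‖ + 1)) * ‖x‖ + ‖L‖ * C := by ring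
    _ ≤ ε * 1 * ‖x‖ + ‖L‖ * C := by
        gcongr
        exact (div_le_one hq).2 (by linarith)
    _ = ε * ‖x‖ + ‖L‖ * C := by rw [mul_one]

/-- Off a compact set the little-o bound and r^a ≤ 1 + r suffice; on it G is bounded. -/
theorem sublinear_of_isLittleO [FiniteDimensional ℝ E] {G : E → E} (hcont : Continuous G) {a : ℝ}
    (ha0 : 0 ≤ a) (ha1 : a ≤ 1) (hG : G =o[cocompact E] fun q => 1 + ‖q‖ ^ a) :
    Sublinear G := by
  intro ε hε
  obtain ⟨s, hs, hbound⟩ := mem_cocompact.1 (hG.def hε)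
  obtain ⟨C, hC⟩ := hs.exists_bound_of_continuousOn hcont.continuousOn
  refine ⟨2 * ε + |C|, by positivity, fun q => ?_⟩
  by_cases hq : q ∈ s
  · have h1 := hC q hq
    have h2 := le_abs_self C
    have h3 : 0 ≤ ε * ‖q‖ := by positivity
    linarith
  · have h1 : ‖G q‖ ≤ ε * ‖1 + ‖q‖ ^ a‖ := hbound hq
    have h2 : ‖q‖ ^ a ≤ 1 + ‖q‖ := by
      rcases le_total ‖q‖ 1 with h | h
      · have := Real.rpow_le_one (norm_nonneg q) h ha0
        have := norm_nonneg q
        linarith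
      · have := Real.rpow_le_rpow_of_exponent_le h ha1
        rw [Real.rpow_one] at this
        linarith
    rw [Real.norm_of_nonneg (by positivity)] at h1
    have h3 : ε * (1 + ‖q‖ ^ a) ≤ ε * (2 + ‖q‖) :=
      mul_le_mul_of_nonneg_left (by linarith) hε.le
    have := abs_nonneg C
    linarith

end Ctrl

/-! ### The network as a sublinear perturbation of its linear part. -/

namespace Network

open ContinuousLinearMap

variable {I : Type*} [Fintype I] [DecidableEq I] {J : Finset I}

omit [DecidableEq I] in
theorem GrowthCondition.sublinear {U : EuclideanSpace ℝ I → ℝ} (h : GrowthCondition U) :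
    Ctrl.Sublinear (gradient U) := by
  obtain ⟨L, hL⟩ := h.lipschitz
  refine Ctrl.sublinear_of_isLittleO hL.continuous (by positivity) ?_ h.growth
  -- For empty `I` the exponent is 1/0, which is 0 by convention.
  rcases Nat.eq_zero_or_pos (Fintype.card I) with h0 | h0
  · simp [h0]
  · have : (1 : ℝ) ≤ Fintype.card I := by exact_mod_cast h0
    rw [div_le_one (by positivity)]
    linarith

/-- The linear part of the vector field. -/
noncomputable def drift (γ lam : J → ℝ) (ωt : Matrix I I ℝ) :
    EuclideanSpace ℝ (J ⊕ I ⊕ I) →L[ℝ] EuclideanSpace ℝ (J ⊕ I ⊕ I) :=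
  Matrix.toEuclideanCLM (𝕜 := ℝ) (driftMatrix γ lam ωt)

theorem adjoint_drift (γ lam : J → ℝ) (ωt : Matrix I I ℝ) :
    adjoint (drift γ lam ωt) = drift γ (-lam) (-ωt) := by
  rw [drift, drift, ← driftMatrix_transpose, ← star_eq_adjoint, ← map_star,
    Matrix.star_eq_conjTranspose, Matrix.conjTranspose_eq_transpose_of_trivial]

theorem drift_pow_apply (γ lam : J → ℝ) (ωt : Matrix I I ℝ) (k : ℕ)
    (x : EuclideanSpace ℝ (J ⊕ I ⊕ I)) :
    ((drift γ lam ωt ^ k) x).ofLp = (driftMatrix γ lam ωt ^ k) *ᵥ x.ofLp := by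
  rw [drift, ← map_pow]
  rfl

/-- The control operator as a continuous linear map. -/
noncomputable def controlCLM (J : Finset I) :
    EuclideanSpace ℝ J →L[ℝ] EuclideanSpace ℝ (J ⊕ I ⊕ I) :=
  LinearMap.toContinuousLinearMap (controlMap J)

omit [Fintype I] in
theorem controlMap_ofLp (ζ : EuclideanSpace ℝ J) :
    (controlMap J ζ).ofLp = Sum.elim ζ.ofLp 0 := by
  simp [controlMap]

theorem adjoint_controlCLM_apply (x : EuclideanSpace ℝ (J ⊕ I ⊕ I)) (j : J) :
    adjoint (controlCLM J) x j = x (Sum.inl j) := by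
  have h1 : inner ℝ (EuclideanSpace.single j (1 : ℝ)) (adjoint (controlCLM J) x)
      = adjoint (controlCLM J) x j := by
    rw [EuclideanSpace.inner_single_left]; simp
  rw [← h1, adjoint_inner_right]
  change inner ℝ (controlMap J (EuclideanSpace.single j 1)) x = _
  rw [EuclideanSpace.inner_eq_star_dotProduct, controlMap_ofLp, star_trivial]
  simp only [dotProduct, Fintype.sum_sum_type, Sum.elim_inl, Sum.elim_inr, Pi.zero_apply, mul_zero,
    Finset.sum_const_zero, add_zero]
  rw [Finset.sum_eq_single j]
  · simp
  · intro k _ hk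
    simp [hk]
  · simp

theorem observable_drift {γ lam : J → ℝ} (hlam : ∀ j, lam j ≠ 0) {Ω ωt : Matrix I I ℝ}
    (hΩ : Ωᵀ = Ω) (hωt : ωtᵀ * ωt = Ω - ∑ j, lam j ^ 2 • (iota j * (iota j)ᵀ))
    (hdet : IsUnit ωt.det) (hK : Kalman Ω (∑ j : J, iota j * (iota j)ᵀ)) :
    Ctrl.Observable (drift γ lam ωt) (adjoint (controlCLM J)) := by
  intro x hx
  have h := eq_zero_of_driftMatrix_pow (γ := γ) hlam hΩ hωt hdet hK (x := x.ofLp) fun k j => by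
    rw [← drift_pow_apply, ← adjoint_controlCLM_apply, hx k]
    rfl
  ext i
  exact congrFun h i

theorem inner_drift_self (γ lam : J → ℝ) (ωt : Matrix I I ℝ)
    (x : EuclideanSpace ℝ (J ⊕ I ⊕ I)) :
    inner ℝ (drift γ lam ωt x) x = -∑ j, γ j * x (Sum.inl j) ^ 2 := by
  rw [real_inner_comm, drift, Matrix.inner_toEuclideanCLM]
  obtain ⟨r, p, s, h⟩ := exists_sum_elim_eq x.ofLp
  rw [h, dotProduct_driftMatrix_mulVec]
  rfl

/-- The position as a continuous linear function of the state. -/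
noncomputable def positionCLM (J : Finset I) (ωt : Matrix I I ℝ) :
    EuclideanSpace ℝ (J ⊕ I ⊕ I) →L[ℝ] EuclideanSpace ℝ I :=
  LinearMap.toContinuousLinearMap
    { toFun := position ωt
      map_add' := fun x y => by
        ext i
        exact congrFun (Matrix.mulVec_add ωt⁻¹ (fun i => x (Sum.inr (Sum.inr i)))
          (fun i => y (Sum.inr (Sum.inr i)))) i
      map_smul' := fun c x => by
        ext i
        exact congrFun (Matrix.mulVec_smul ωt⁻¹ c (fun i => x (Sum.inr (Sum.inr i)))) i }

/-- The force `v ↦ (0, -v, 0)`. -/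
noncomputable def forceCLM (J : Finset I) :
    EuclideanSpace ℝ I →L[ℝ] EuclideanSpace ℝ (J ⊕ I ⊕ I) :=
  LinearMap.toContinuousLinearMap
    { toFun := fun v => WithLp.toLp 2 (-Sum.elim (0 : J → ℝ) (Sum.elim v.ofLp (0 : I → ℝ)))
      map_add' := fun x y => by
        ext (j | i | i) <;> simp [add_comm]
      map_smul' := fun c x => by
        ext (j | i | i) <;> simp }

theorem semiMarkovField_eq (γ lam : J → ℝ) (ωt : Matrix I I ℝ) (U : EuclideanSpace ℝ I → ℝ) :
    semiMarkovField γ lam ωt U = fun x =>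
      drift γ lam ωt x + forceCLM J (gradient U (positionCLM J ωt x)) := by
  ext x i
  change (driftMatrix γ lam ωt *ᵥ x.ofLp) i - _ = (driftMatrix γ lam ωt *ᵥ x.ofLp) i + -_
  exact sub_eq_add_neg _ _

theorem exists_lipschitzWith_semiMarkovField (γ lam : J → ℝ) (ωt : Matrix I I ℝ)
    {U : EuclideanSpace ℝ I → ℝ} (hU : GrowthCondition U) :
    ∃ K, LipschitzWith K fun x =>
      drift γ lam ωt x + forceCLM J (gradient U (positionCLM J ωt x)) := by
  obtain ⟨L, hL⟩ := hU.lipschitz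
  exact ⟨_, (drift γ lam ωt).lipschitz.add
    ((forceCLM J).lipschitz.comp (hL.comp (positionCLM J ωt).lipschitz))⟩

end Network

theorem mainTheorem7 {I : Type*} [Fintype I] [DecidableEq I] (J : Finset I) (hJ : J.Nonempty)
    (ω : Matrix I I ℝ) (hω : IsUnit ω.det) (γ : J → ℝ) (hγ : ∀ j, 0 < γ j) :
    ∃ lam₀ > (0 : ℝ), ∀ lam : J → ℝ, (∀ j, 0 < lam j ∧ lam j ≤ lam₀) →
      (∃ ωt : Matrix I I ℝ, ωtᵀ * ωt =
        ωᵀ * ω - ∑ j, lam j ^ 2 • (Network.iota j * (Network.iota j)ᵀ)) ∧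
      ∀ ωt : Matrix I I ℝ, ωtᵀ * ωt =
          ωᵀ * ω - ∑ j, lam j ^ 2 • (Network.iota j * (Network.iota j)ᵀ) →
        IsUnit ωt.det ∧
        (Network.Kalman (ωᵀ * ω) (∑ j : J, Network.iota j * (Network.iota j)ᵀ) →
          ∃ g : EuclideanSpace ℝ (J ⊕ I ⊕ I) →ₗ[ℝ] EuclideanSpace ℝ (J ⊕ I ⊕ I) →ₗ[ℝ] ℝ,
            Ctrl.IsScalarProduct g ∧
            ∀ U : EuclideanSpace ℝ I → ℝ,
              Network.GrowthCondition U → Network.PerturbationCondition U →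
              Ctrl.WellPosed (Network.semiMarkovField γ lam ωt U) (Network.controlMap J) ∧
              Ctrl.Dissipative g (Network.semiMarkovField γ lam ωt U) ∧
              ∃ xhat : EuclideanSpace ℝ (J ⊕ I ⊕ I),
                Ctrl.ApproxControllableTo (Network.semiMarkovField γ lam ωt U)
                  (Network.controlMap J) xhat ∧
                Ctrl.SolidlyControllableFrom (Network.semiMarkovField γ lam ωt U)
                  (Network.controlMap J) xhat) := by

  obtain ⟨lam₀, hlam₀, hpos⟩ := Network.exists_forall_posDef hω J
  refine ⟨lam₀, hlam₀, fun lam hlam => ⟨exists_transpose_mul_self_eq (hpos lam hlam).posSemidef,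
    fun ωt hωt => ?_⟩⟩
  have hdet : IsUnit ωt.det := by
    have h := (Matrix.isUnit_iff_isUnit_det _).1 (hpos lam hlam).isUnit
    rw [← hωt, Matrix.det_mul] at h
    exact isUnit_of_mul_isUnit_right h
  refine ⟨hdet, fun hK => ?_⟩
  have hΩ : (ωᵀ * ω)ᵀ = ωᵀ * ω := by rw [Matrix.transpose_mul, Matrix.transpose_transpose]
  have hobs : Ctrl.Observable (Network.drift γ lam ωt)
      (ContinuousLinearMap.adjoint (Network.controlCLM J)) :=
    Network.observable_drift (fun j => (hlam j).1.ne') hΩ hωt hdet hK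
  have hobs' : Ctrl.Observable (ContinuousLinearMap.adjoint (Network.drift γ lam ωt))
      (ContinuousLinearMap.adjoint (Network.controlCLM J)) := by
    rw [Network.adjoint_drift]
    refine Network.observable_drift (fun j => neg_ne_zero.2 (hlam j).1.ne') hΩ ?_ ?_ hK
    · simpa using hωt
    · rw [Matrix.det_neg]
      exact ((isUnit_one.neg).pow _).mul hdet
  obtain ⟨g, hg, hdiss⟩ := Ctrl.exists_isScalarProduct_dissipative hobs
    (fun x => by
      rw [Network.inner_drift_self]
      exact neg_nonpos.2 (Finset.sum_nonneg fun j _ => mul_nonneg (hγ j).le (sq_nonneg _)))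
    (fun x hx => by
      rw [Network.inner_drift_self, neg_eq_zero, Finset.sum_eq_zero_iff_of_nonneg
        fun j _ => mul_nonneg (hγ j).le (sq_nonneg _)] at hx
      ext j
      rw [Network.adjoint_controlCLM_apply]
      have h := (mul_eq_zero.1 (hx j (Finset.mem_univ j))).resolve_left (hγ j).ne'
      exact pow_eq_zero_iff two_ne_zero |>.1 h)
  refine ⟨g, hg, fun U hU _ => ?_⟩
  have hF := hU.sublinear.comp_continuousLinearMap (Network.positionCLM J ωt) (Network.forceCLM J)
  obtain ⟨K, hlip⟩ := Network.exists_lipschitzWith_semiMarkovField γ lam ωt hU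
  have hB : Network.controlMap J = (Network.controlCLM J : _ →ₗ[ℝ] _) := rfl
  rw [Network.semiMarkovField_eq, hB]
  -- Any point can serve as x̂; the origin is taken.
  exact ⟨Ctrl.wellPosed_of_lipschitzWith hlip _, hdiss _ hF, 0,
    Ctrl.controllable_of_sublinear hobs' hF hlip 0⟩
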